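/- Let $T$ be the $7$-vertex triangulated torus with vertices $v_1,\dots,v_7$ and the $14$ triangles $v_1v_2v_4$, $v_2v_4v_5$, $v_2v_3v_5$, $v_3v_5v_6$, $v_1v_5v_6$, $v_1v_2v_6$, $v_2v_6v_7$, $v_2v_3v_7$, $v_1v_3v_7$, $v_1v_5v_7$, $v_4v_5v_7$, $v_4v_6v_7$, $v_3v_4v_6$, $v_1v_3v_4$. This is a triangulated closed connected orientable surface of genus $1$. For all integers $g\ge 2$, $0\le i\le g-2$ and $d$ with $|d|=g+i$, there exist a triangulated closed connected orientable surface $K$ of genus $g$ with exactly $6|d|+1$ vertices and a simplicial map $f:K\to T$ of degree $d$; that is, $H_2(K;\mathbb Z)\cong\mathbb Z$ and $H_2(T;\mathbb Z)\cong\mathbb Z$ have generators $\alpha$ and $\beta$ (orientations) with $f_*\alpha=d\,\beta$. -/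

import Mathlib

namespace SurfaceMaps

section

variable {V W : Type} [Fintype V] [DecidableEq V] [Fintype W] [DecidableEq W]

/-! ### Geometric carrier -/

/-- The geometric carrier `‖K‖` of a finite simplicial complex: the points of the standard simplex
of `ℝ^V` (barycentric coordinates) whose set of non-zero coordinates is a face of `K`.
It is the union of the geometric simplices spanned by the `e_v`, `v ∈ s`, over the faces `s`,
and carries the subspace topology. -/
def carrier (K : AbstractSimplicialComplex V) : Set (V → ℝ) :=
  {x | x ∈ stdSimplex ℝ V ∧ Finset.univ.filter (fun v => x v ≠ 0) ∈ K.faces}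

/-! ### Simplicial homology -/

/-- Oriented simplicial `n`-chains with integer coefficients. A chain `c` is recorded through the
coefficients `c (v₀, …, vₙ)` of the oriented simplices `[v₀ … vₙ]`: a permutation of the vertices
changes the coefficient by its sign, and only tuples of distinct vertices spanning a face of `K`
may have a non-zero coefficient. -/
def Chain (K : AbstractSimplicialComplex V) (n : ℕ) : Submodule ℤ ((Fin (n + 1) → V) → ℤ) where
  carrier := {c |
    (∀ (σ : Equiv.Perm (Fin (n + 1))) v, c (v ∘ σ) = (Equiv.Perm.sign σ : ℤ) * c v) ∧
    ∀ v, c v ≠ 0 → Function.Injective v ∧ Finset.univ.image v ∈ K.faces}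
  add_mem' := by
    rintro a b ⟨ha, ha'⟩ ⟨hb, hb'⟩
    refine ⟨fun σ v => by simp only [Pi.add_apply, ha, hb, mul_add], fun v hv => ?_⟩
    by_cases h : a v = 0
    · exact hb' v (by simpa [h] using hv)
    · exact ha' v h
  zero_mem' := ⟨fun σ v => by simp, fun v hv => by simp at hv⟩
  smul_mem' := by
    rintro r a ⟨ha, ha'⟩
    refine ⟨fun σ v => by simp only [Pi.smul_apply, ha, smul_eq_mul]; ring, fun v hv => ?_⟩
    exact ha' v (fun h => hv (by simp [h]))

/-- The boundary operator: the coefficient of `∂c` at `[w₀ … wₙ]` is the sum over all vertices `x`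
of the coefficients of `c` at `[x w₀ … wₙ]`. On a single oriented simplex this is
`∂[v₀ … vₙ₊₁] = ∑ᵢ (-1)ⁱ [v₀ … v̂ᵢ … vₙ₊₁]`. -/
def boundary (K : AbstractSimplicialComplex V) (n : ℕ) : Chain K (n + 1) →ₗ[ℤ] Chain K n where
  toFun c := ⟨fun w => ∑ x, c.1 (Fin.cons x w), by
    refine ⟨fun σ w => ?_, fun w hw => ?_⟩
    · rw [Finset.mul_sum]
      refine Finset.sum_congr rfl fun x _ => ?_
      have h := c.2.1 (Equiv.Perm.decomposeFin.symm (0, σ)) (Fin.cons x w)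
      have e : (Fin.cons x w : Fin (n + 1 + 1) → V) ∘ (Equiv.Perm.decomposeFin.symm (0, σ))
          = Fin.cons x (w ∘ σ) := by
        funext j
        refine Fin.cases ?_ (fun j => ?_) j <;> simp
      rw [e] at h
      rw [h]
      simp
    · obtain ⟨x, -, hx⟩ := Finset.exists_ne_zero_of_sum_ne_zero hw
      obtain ⟨hi, hf⟩ := c.2.2 _ hx
      refine ⟨(Fin.cons_injective_iff.1 hi).2, (K.isRelLowerSet_faces hf).2 ?_ ?_⟩
      · intro y hy
        obtain ⟨j, -, rfl⟩ := Finset.mem_image.1 hy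
        exact Finset.mem_image.2 ⟨j.succ, Finset.mem_univ _, by simp⟩
      · exact Finset.univ_nonempty.image _⟩
  map_add' a b := by
    ext w
    simp [Finset.sum_add_distrib]
  map_smul' r a := by
    ext w
    simp [Finset.mul_sum]

/-- The group of 2-cycles. -/
abbrev Cycles₂ (K : AbstractSimplicialComplex V) : Submodule ℤ (Chain K 2) :=
  LinearMap.ker (boundary K 1)

/-- The second simplicial homology group `H₂(K; ℤ)`: 2-cycles modulo boundaries of 3-chains. -/
abbrev H₂ (K : AbstractSimplicialComplex V) : Type :=
  Cycles₂ K ⧸ (LinearMap.range (boundary K 2)).submoduleOf (Cycles₂ K)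

/-! ### Simplicial maps and their degree -/

/-- A simplicial map: a map of vertices sending every face of `K` onto a face of `L`. -/
structure SimplicialMap (K : AbstractSimplicialComplex V) (L : AbstractSimplicialComplex W) where
  toFun : V → W
  map_faces : ∀ s ∈ K.faces, s.image toFun ∈ L.faces

variable {K : AbstractSimplicialComplex V} {L : AbstractSimplicialComplex W}

/-- The induced map on chains: `[v₀ … vₙ] ↦ [f v₀ … f vₙ]`, read as `0` when `f v₀, …, f vₙ` are
not distinct. In terms of coefficients one sums over the tuples lying over a given tuple; over a
tuple with a repetition this sum is `0`. -/
def SimplicialMap.chainMap (f : SimplicialMap K L) (n : ℕ) : Chain K n →ₗ[ℤ] Chain L n where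
  toFun c := ⟨fun w => ∑ v with f.toFun ∘ v = w, c.1 v, by
    have alt : ∀ (σ : Equiv.Perm (Fin (n + 1))) (w : Fin (n + 1) → W),
        ∑ v with f.toFun ∘ v = w ∘ σ, c.1 v
          = (Equiv.Perm.sign σ : ℤ) * ∑ v with f.toFun ∘ v = w, c.1 v := by
      intro σ w
      rw [Finset.mul_sum]
      symm
      refine Finset.sum_bij (fun v _ => v ∘ σ) ?_ ?_ ?_ ?_
      · intro v hv
        simp only [Finset.mem_filter, Finset.mem_univ, true_and] at hv ⊢
        rw [← hv]; rfl
      · intro v _ v' _ h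
        exact σ.surjective.injective_comp_right h
      · intro v hv
        simp only [Finset.mem_filter, Finset.mem_univ, true_and] at hv
        refine ⟨v ∘ σ.symm, ?_, by funext j; simp⟩
        simp only [Finset.mem_filter, Finset.mem_univ, true_and]
        funext j
        simpa using congrFun hv (σ.symm j)
      · intro v _
        exact (c.2.1 σ v).symm
    refine ⟨alt, fun w hw => ⟨?_, ?_⟩⟩
    · by_contra hni
      simp only [Function.Injective, not_forall] at hni
      obtain ⟨a, b, hab, hne⟩ := hni
      have h := alt (Equiv.swap a b) w
      have e : w ∘ Equiv.swap a b = w := by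
        funext j
        simp only [Function.comp_apply, Equiv.swap_apply_def]
        split_ifs with h1 h2
        · rw [h1, hab]
        · rw [h2, hab]
        · rfl
      rw [e, Equiv.Perm.sign_swap hne] at h
      apply hw
      simp only [Units.val_neg, Units.val_one] at h
      show ∑ v with f.toFun ∘ v = w, c.1 v = 0
      linarith
    · obtain ⟨v, hv, hc⟩ := Finset.exists_ne_zero_of_sum_ne_zero hw
      simp only [Finset.mem_filter, Finset.mem_univ, true_and] at hv
      have := f.map_faces _ (c.2.2 v hc).2
      rwa [Finset.image_image, hv] at this⟩
  map_add' a b := by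
    ext w
    simp [Finset.sum_add_distrib]
  map_smul' r a := by
    ext w
    simp [Finset.mul_sum]

theorem SimplicialMap.boundary_chainMap (f : SimplicialMap K L) (n : ℕ) (c : Chain K (n + 1)) :
    boundary L n (f.chainMap (n + 1) c) = f.chainMap n (boundary K n c) := by
  ext w
  show ∑ y, ∑ v with f.toFun ∘ v = Fin.cons y w, c.1 v
    = ∑ u with f.toFun ∘ u = w, ∑ x, c.1 (Fin.cons x u)
  have key : ∀ (x : V) (u : Fin (n + 1) → V) (y : W),
      (f.toFun ∘ (Fin.cons x u : Fin (n + 1 + 1) → V) = Fin.cons y w)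
        ↔ (f.toFun x = y ∧ f.toFun ∘ u = w) := by
    intro x u y
    constructor
    · intro h
      exact ⟨by simpa using congrFun h 0, by funext j; simpa using congrFun h j.succ⟩
    · rintro ⟨h1, h2⟩
      funext j
      refine Fin.cases ?_ (fun j => ?_) j
      · simpa using h1
      · simpa using congrFun h2 j
  simp only [Finset.sum_filter]
  have h1 : ∀ y, (∑ v : Fin (n + 1 + 1) → V, if f.toFun ∘ v = Fin.cons y w then c.1 v else 0)
      = ∑ p : V × (Fin (n + 1) → V),
        if f.toFun p.1 = y ∧ f.toFun ∘ p.2 = w then c.1 (Fin.cons p.1 p.2) else 0 := by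
    intro y
    rw [← (Fin.consEquiv (fun _ : Fin (n + 1 + 1) => V)).sum_comp]
    refine Finset.sum_congr rfl fun p _ => ?_
    exact if_congr (key p.1 p.2 y) rfl rfl
  simp only [h1]
  rw [Finset.sum_comm]
  have h2 : ∀ p : V × (Fin (n + 1) → V),
      (∑ y, if f.toFun p.1 = y ∧ f.toFun ∘ p.2 = w then c.1 (Fin.cons p.1 p.2) else 0)
        = if f.toFun ∘ p.2 = w then c.1 (Fin.cons p.1 p.2) else 0 := by
    intro p
    simp [ite_and]
  rw [Finset.sum_congr rfl fun p _ => h2 p, Fintype.sum_prod_type, Finset.sum_comm]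
  refine Finset.sum_congr rfl fun u _ => ?_
  split_ifs <;> simp

/-- The induced homomorphism `f_* : H₂(K; ℤ) → H₂(L; ℤ)`. -/
def SimplicialMap.mapH₂ (f : SimplicialMap K L) : H₂ K →ₗ[ℤ] H₂ L :=
  Submodule.mapQ _ _
    ((f.chainMap 2).restrict (p := Cycles₂ K) (q := Cycles₂ L) (fun c hc => by
      rw [LinearMap.mem_ker] at hc ⊢
      rw [f.boundary_chainMap, hc, map_zero]))
    (by
      rintro ⟨z, hz⟩ ⟨b, hb⟩
      refine ⟨f.chainMap 3 b, ?_⟩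
      rw [f.boundary_chainMap, hb]
      rfl)

/-- `α` freely generates the infinite cyclic group `A` (in particular `A ≅ ℤ`). -/
def IsInfiniteCyclicGenerator {A : Type} [AddCommGroup A] (α : A) : Prop :=
  Function.Bijective (fun n : ℤ => n • α)

/-- With respect to the orientations given by the classes `α ∈ H₂(K; ℤ) ≅ ℤ` and
`β ∈ H₂(L; ℤ) ≅ ℤ`, which have to be generators, the simplicial map `f` has degree `d`. -/
def HasDegree (f : SimplicialMap K L) (α : H₂ K) (β : H₂ L) (d : ℤ) : Prop :=
  IsInfiniteCyclicGenerator α ∧ IsInfiniteCyclicGenerator β ∧ f.mapH₂ α = d • β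

/-! ### Triangulated surfaces -/

/-- The number of `k`-dimensional faces. -/
noncomputable def faceCount (K : AbstractSimplicialComplex V) (k : ℕ) : ℕ :=
  {s ∈ K.faces | s.card = k + 1}.ncard

/-- A coherent orientation exists: one can choose a sign for every ordered triangle, changing by
the sign of the permutation when its vertices are permuted, such that any two triangles
`{x, u, v}`, `{y, u, v}` sharing exactly an edge are oppositely oriented with respect to the
orderings `x, u, v` and `y, u, v`. -/
def CoherentlyOrientable (K : AbstractSimplicialComplex V) : Prop :=
  ∃ ε : (Fin 3 → V) → ℤ,
    (∀ (σ : Equiv.Perm (Fin 3)) t, ε (t ∘ σ) = (Equiv.Perm.sign σ : ℤ) * ε t) ∧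
    (∀ t, Function.Injective t → Finset.univ.image t ∈ K.faces → ε t = 1 ∨ ε t = -1) ∧
    ∀ x y u v : V, x ≠ y → u ≠ v → x ≠ u → x ≠ v → y ≠ u → y ≠ v →
      {x, u, v} ∈ K.faces → {y, u, v} ∈ K.faces → ε ![x, u, v] = - ε ![y, u, v]

/-- `K` is a triangulated closed connected orientable surface of genus `g`: a pure 2-dimensional
complex whose carrier (automatically compact and metrizable) is a connected topological
2-manifold without boundary, which admits a coherent orientation, and whose Euler characteristic
is `2 - 2g`. -/
structure IsTriangulatedOrientableSurface (K : AbstractSimplicialComplex V) (g : ℕ) : Prop where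
  pure : ∀ s ∈ K.faces, ∃ t ∈ K.faces, s ⊆ t ∧ t.card = 3
  connected : ConnectedSpace (carrier K)
  manifold : Nonempty (ChartedSpace (EuclideanSpace ℝ (Fin 2)) (carrier K))
  orientable : CoherentlyOrientable K
  euler : (faceCount K 0 : ℤ) - faceCount K 1 + faceCount K 2 = 2 - 2 * g

end

/-! ### The 7-vertex torus -/

/-- The 14 triangles of the 7-vertex torus on the vertices `v₁, …, v₇`, where `vⱼ` is the element
`j - 1` of `Fin 7`. -/
def torusTriangles : Finset (Finset (Fin 7)) :=
  {{0, 1, 3}, {1, 3, 4}, {1, 2, 4}, {2, 4, 5}, {0, 4, 5}, {0, 1, 5}, {1, 5, 6},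
   {1, 2, 6}, {0, 2, 6}, {0, 4, 6}, {3, 4, 6}, {3, 5, 6}, {2, 3, 5}, {0, 2, 3}}

/-- The 7-vertex triangulation of the torus: all non-empty subsets of the 14 triangles. -/
def torus₇ : AbstractSimplicialComplex (Fin 7) where
  faces := {s | s.Nonempty ∧ ∃ t ∈ torusTriangles, s ⊆ t}
  isRelLowerSet_faces := fun _ hs =>
    ⟨hs.1, fun _ hts ht => ⟨ht, hs.2.imp fun _ h => ⟨h.1, hts.trans h.2⟩⟩⟩
  singleton_mem := by
    intro v
    refine ⟨Finset.singleton_nonempty v, ?_⟩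
    revert v
    decide

end SurfaceMaps

/-! Put `n = |d| = g + i`. The surface is a ramified covering of the torus with `n` sheets,
corrected along one edge. The complement of the open star of vertex `6` is a torus with one hole,
whose fundamental group is free of rank two. Any two permutations `α`, `β` of the sheets therefore
define a covering of it, here with `6n` vertices and `8n` triangles. The boundary hexagon carries a
commutator of `α` and `β`.

Cut this covering off from the triangles at vertex `6` along the lifts of the edge `{0, 2}` and glue
back with an extra permutation `τ`, a cycle of length `m ≥ 2`. The total monodromy around vertex `6`
becomes `ρ = β⁻¹αβα⁻¹τ`. If `ρ` is an `n`-cycle, one vertex lies over `6`, which gives `6n + 1`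
vertices and makes this vertex adjacent to all others. The lifts of `{0, 2}` moved by `τ` leave a
hole bounded by a `2m`-gon. It is filled without new vertices by a fan of `2m - 2` triangles, all of
which collapse onto the edge `{0, 2}` and do not count for the degree. Hence the degree is `n`, and
`2V - F = 12n + 2 - (14n + 2m - 2) = 4 - 2(n + m)`, so the genus is `(n + m) / 2`. The choice `m = n
- 2i` gives `g`.

It remains to write an `n`-cycle as a commutator times an `(n - 2i)`-cycle. A `(2i + 1)`-cycle and
an `(n - 2i)`-cycle meeting in one point multiply to an `n`-cycle, and a permutation of odd order is
a commutator (`exists_perms`). The condition `i ≤ g - 2` says exactly that `m ≥ 2`. Negative degrees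
come from reversing the orientation.

That the result is a closed oriented surface is reduced to conditions on directed edges and on the
rotation around each vertex (`IsOrientedTriangulation`). From these follow the manifold property,
since an open star is a cone over a cycle and hence a plane, the Euler characteristic, and the fact
that the sum of all oriented triangles generates `H₂`. The degree is then a signed count over one
triangle. -/

set_option linter.unusedSectionVars false

/-! ### The cone over a cycle is a plane. -/

namespace SurfaceMaps
open Complex

/-- The cone over the cycle graph on `Fin m`. -/
def cycleCone (m : ℕ) [NeZero m] : Set (Fin m → ℝ) :=
  {y | (∀ i, 0 ≤ y i) ∧ ∃ j, ∀ i, y i ≠ 0 → i = j ∨ i = j + 1}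

/-- The unit complex number of angle `2πj/m`. -/
noncomputable def rootDir (m : ℕ) (j : ℤ) : ℂ := exp ((2 * Real.pi / m * j : ℝ) * I)

theorem rootDir_add (m : ℕ) (j k : ℤ) : rootDir m (j + k) = rootDir m j * rootDir m k := by
  unfold rootDir
  rw [← Complex.exp_add]; congr 1; push_cast; ring

theorem rootDir_mul_self {m : ℕ} (hm : m ≠ 0) (k : ℤ) : rootDir m (m * k) = 1 := by
  unfold rootDir
  rw [Complex.exp_eq_one_iff]
  refine ⟨k, ?_⟩
  have : (m : ℂ) ≠ 0 := by exact_mod_cast hm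
  push_cast; field_simp

theorem rootDir_emod {m : ℕ} (hm : m ≠ 0) (j : ℤ) : rootDir m (j % m) = rootDir m j := by
  conv_rhs => rw [← Int.emod_add_mul_ediv j m]
  rw [rootDir_add, rootDir_mul_self hm, mul_one]

theorem rootDir_re (m : ℕ) (j : ℤ) : (rootDir m j).re = Real.cos (2 * Real.pi / m * j) := by
  rw [rootDir, Complex.exp_ofReal_mul_I_re]

theorem rootDir_im (m : ℕ) (j : ℤ) : (rootDir m j).im = Real.sin (2 * Real.pi / m * j) := by
  rw [rootDir, Complex.exp_ofReal_mul_I_im]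

theorem norm_rootDir (m : ℕ) (j : ℤ) : ‖rootDir m j‖ = 1 := by
  rw [rootDir, Complex.norm_exp_ofReal_mul_I]

theorem rootDir_fin_succ {m : ℕ} [NeZero m] (j : Fin m) :
    rootDir m ((j + 1 : Fin m) : ℕ) = rootDir m ((j : ℕ) + 1) := by
  rw [← rootDir_emod (NeZero.ne m) ((j : ℕ) + 1)]
  congr 1
  rw [Fin.val_add, Fin.val_one']
  push_cast
  simp

theorem angle_pos {m : ℕ} (hm : 3 ≤ m) : 0 < 2 * Real.pi / m := by
  have : 0 < m := by lia
  positivity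

theorem angle_le {m : ℕ} (hm : 3 ≤ m) : 2 * Real.pi / m ≤ 2 * Real.pi / 3 := by
  have : (3 : ℝ) ≤ m := by exact_mod_cast hm
  gcongr

theorem sin_angle_pos {m : ℕ} (hm : 3 ≤ m) : 0 < Real.sin (2 * Real.pi / m) := by
  have := angle_le hm
  apply Real.sin_pos_of_pos_of_lt_pi (angle_pos hm)
  linarith [Real.pi_pos]

/-- Every complex number lies in one of the sectors spanned by consecutive directions. -/
theorem exists_mem_sector {m : ℕ} (hm : 3 ≤ m) (z : ℂ) :
    ∃ j < m, ∃ s t : ℝ, 0 ≤ s ∧ 0 ≤ t ∧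
      z = s * rootDir m (j : ℕ) + t * rootDir m ((j : ℕ) + 1) := by
  have hm0 : m ≠ 0 := by lia
  have hδ := angle_pos hm
  have hδ' := angle_le hm
  have hsin := sin_angle_pos hm
  set δ := 2 * Real.pi / m with hδdef
  set J : ℤ := ⌊arg z / δ⌋ with hJ
  have h1 : (J : ℝ) * δ ≤ arg z := by
    have := Int.floor_le (arg z / δ)
    rwa [le_div_iff₀ hδ] at this
  have h2 : arg z ≤ (J + 1) * δ := by
    have := (Int.lt_floor_add_one (arg z / δ)).le
    rwa [div_le_iff₀ hδ] at this
  have hpi := Real.pi_pos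
  have hmod := Int.emod_nonneg J (b := m) (by lia)
  have hmod' := Int.emod_lt_of_pos J (b := m) (by lia)
  -- The coordinates of `z` along the two bounding directions of its sector, by the law of sines.
  refine ⟨(J % m).toNat, by lia, ‖z‖ * Real.sin ((J + 1) * δ - arg z) / Real.sin δ,
    ‖z‖ * Real.sin (arg z - J * δ) / Real.sin δ, ?_, ?_, ?_⟩
  · have := Real.sin_nonneg_of_nonneg_of_le_pi (x := (J + 1) * δ - arg z) (by linarith)
      (by linarith)
    positivity
  · have := Real.sin_nonneg_of_nonneg_of_le_pi (x := arg z - J * δ) (by linarith)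
      (by linarith)
    positivity
  · rw [Int.toNat_of_nonneg hmod, rootDir_add, rootDir_emod hm0, ← rootDir_add]
    have key : ∀ x y c : ℝ, Real.sin x * Real.cos (c - y) + Real.sin y * Real.cos (c + x)
        = Real.sin (x + y) * Real.cos c ∧
        Real.sin x * Real.sin (c - y) + Real.sin y * Real.sin (c + x)
        = Real.sin (x + y) * Real.sin c := by
      intro x y c
      rw [Real.cos_sub, Real.cos_add, Real.sin_sub, Real.sin_add, Real.sin_add]
      constructor <;> ring
    obtain ⟨e1, e2⟩ := key ((J + 1) * δ - arg z) (arg z - J * δ) (arg z)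
    rw [show arg z - (arg z - J * δ) = δ * J by ring,
      show arg z + ((J + 1) * δ - arg z) = δ * (J + 1) by ring,
      show (J + 1) * δ - arg z + (arg z - J * δ) = δ by ring] at e1 e2
    clear_value δ
    apply Complex.ext
    · simp only [add_re, re_ofReal_mul, rootDir_re, ← hδdef, Int.cast_add, Int.cast_one]
      rw [← Complex.norm_mul_cos_arg z, div_mul_eq_mul_div, div_mul_eq_mul_div, ← add_div,
        eq_div_iff hsin.ne']
      linear_combination -‖z‖ * e1
    · simp only [add_im, im_ofReal_mul, rootDir_im, ← hδdef, Int.cast_add, Int.cast_one]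
      rw [← Complex.norm_mul_sin_arg z, div_mul_eq_mul_div, div_mul_eq_mul_div, ← add_div,
        eq_div_iff hsin.ne']
      linear_combination -‖z‖ * e2

/-- Law of cosines: since `m ≥ 3` the angle is at most `2π/3`, its cosine is at least `-1/2`, and
`s² + t² - st ≥ (s² + t²) / 2`. This bound makes `coneMap` proper on the cone. -/
theorem sq_norm_sector {m : ℕ} (hm : 3 ≤ m) (j : ℤ) {s t : ℝ} (hs : 0 ≤ s) (ht : 0 ≤ t) :
    s ^ 2 + t ^ 2 ≤ 2 * ‖s * rootDir m j + t * rootDir m (j + 1)‖ ^ 2 := by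
  have e : (s * rootDir m j + t * rootDir m (j + 1) : ℂ)
      = rootDir m j * (s + t * rootDir m 1) := by rw [rootDir_add]; ring
  rw [e, norm_mul, norm_rootDir, one_mul, ← Complex.normSq_eq_norm_sq, Complex.normSq_apply]
  simp only [add_re, add_im, ofReal_re, ofReal_im, re_ofReal_mul, im_ofReal_mul, rootDir_re,
    rootDir_im, Int.cast_one, mul_one]
  have hc : -(1 / 2) ≤ Real.cos (2 * Real.pi / m) := by
    rw [show -(1 / 2 : ℝ) = Real.cos (2 * Real.pi / 3) by
      rw [show 2 * Real.pi / 3 = Real.pi - Real.pi / 3 by ring, Real.cos_pi_sub,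
        Real.cos_pi_div_three]]
    apply Real.cos_le_cos_of_nonneg_of_le_pi (angle_pos hm).le _ (angle_le hm)
    linarith [Real.pi_pos]
  have h1 := Real.sin_sq_add_cos_sq (2 * Real.pi / m)
  set c := Real.cos (2 * Real.pi / m)
  set q := Real.sin (2 * Real.pi / m)
  have : (s + t * c) * (s + t * c) + (0 + t * q) * (0 + t * q)
      = s ^ 2 + t ^ 2 + 2 * (s * t) * c := by linear_combination t ^ 2 * h1
  rw [this]
  nlinarith [mul_nonneg hs ht, sq_nonneg (s - t)]

/-- The half-open sectors are disjoint. -/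
theorem sector_index_unique {m : ℕ} (hm : 3 ≤ m) {j k : ℕ} (hj : j < m) (hk : k < m)
    {s t s' t' : ℝ} (hs : 0 < s) (ht : 0 ≤ t) (hs' : 0 < s') (ht' : 0 ≤ t')
    (h : (s * rootDir m j + t * rootDir m (j + 1) : ℂ)
      = s' * rootDir m k + t' * rootDir m (k + 1)) : j = k := by
  have hm0 : m ≠ 0 := by lia
  have hδ := angle_pos hm
  have hsin := sin_angle_pos hm
  set q : ℤ := ((j : ℤ) - k) % m with hq
  have hq0 : 0 ≤ q := Int.emod_nonneg _ (by lia)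
  have hqm : q < m := Int.emod_lt_of_pos _ (by lia)
  -- Rotate so that the second sector starts at the positive real axis (`a = 0`) or ends there (`a =
  -- -1`), and compare imaginary parts.
  have hrot : ∀ a : ℤ, (s * rootDir m (q + a) + t * rootDir m (q + 1 + a) : ℂ)
      = s' * rootDir m a + t' * rootDir m (1 + a) := by
    intro a
    have e1 : rootDir m q = rootDir m j * rootDir m (-k) := by
      rw [hq, rootDir_emod hm0, ← rootDir_add]; rfl
    have e2 : rootDir m k * rootDir m (-k) = 1 := by
      rw [← rootDir_add]; simp [rootDir]
    rw [rootDir_add, rootDir_add m 1, rootDir_add m (q + 1), rootDir_add m q 1, e1]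
    rw [rootDir_add, rootDir_add] at h
    linear_combination (rootDir m (-k) * rootDir m a) * h
      + (s' * rootDir m a + t' * rootDir m 1 * rootDir m a) * e2
  have i0 := congrArg Complex.im (hrot 0)
  have i1 := congrArg Complex.im (hrot (-1))
  simp only [add_im, im_ofReal_mul, rootDir_im] at i0 i1
  have hδm : 2 * Real.pi / m * m = 2 * Real.pi := by
    have : (m : ℝ) ≠ 0 := by exact_mod_cast hm0
    field_simp
  set δ := 2 * Real.pi / m
  push_cast at i0 i1
  simp only [add_zero, mul_zero, Real.sin_zero, mul_one, zero_add, add_neg_cancel_right,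
    mul_neg, Real.sin_neg] at i0 i1
  have hqR : (0 : ℝ) ≤ q := by exact_mod_cast hq0
  have hqmR : (q : ℝ) + 1 ≤ m := by exact_mod_cast hqm
  have hq_zero : q = 0 := by
    by_contra hne
    have hq1 : (1 : ℝ) ≤ q := by
      have : 1 ≤ q := by lia
      exact_mod_cast this
    -- In the upper half plane the rotation by `a = -1` gives a non-negative left side and a
    -- negative right side. In the lower half plane `a = 0` gives a negative left side and a
    -- non-negative right side.
    by_cases hle : δ * q ≤ Real.pi
    · have a1 : 0 ≤ Real.sin (δ * (q + -1)) :=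
        Real.sin_nonneg_of_nonneg_of_le_pi (by nlinarith) (by nlinarith)
      have a2 : 0 ≤ Real.sin (δ * q) :=
        Real.sin_nonneg_of_nonneg_of_le_pi (by nlinarith) hle
      have := mul_nonneg hs.le a1
      have := mul_nonneg ht a2
      have := mul_pos hs' hsin
      nlinarith
    · push Not at hle
      have hb : δ * (q + 1) ≤ 2 * Real.pi := by
        rw [← hδm]; gcongr
      have a1 : Real.sin (δ * q) < 0 := by
        rw [← Real.sin_sub_two_pi]
        apply Real.sin_neg_of_neg_of_neg_pi_lt <;> nlinarith
      have a2 : Real.sin (δ * (q + 1)) ≤ 0 := by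
        rw [← Real.sin_sub_two_pi]
        apply Real.sin_nonpos_of_nonpos_of_neg_pi_le <;> nlinarith
      have := mul_neg_of_pos_of_neg hs a1
      have := mul_nonneg ht (neg_nonneg.2 a2)
      have := mul_nonneg ht' hsin.le
      nlinarith
  have := Int.emod_emod_of_dvd ((j : ℤ) - k) (dvd_refl (m : ℤ))
  have hd : (m : ℤ) ∣ (j : ℤ) - k := Int.dvd_of_emod_eq_zero hq_zero
  obtain ⟨r, hr⟩ := hd
  have : r = 0 := by
    by_contra hr0
    rcases lt_or_gt_of_ne hr0 with h' | h' <;> nlinarith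
  subst this
  lia

/-- The linear map sending the `j`-th coordinate vector to the `j`-th direction. -/
noncomputable def coneMap (m : ℕ) (y : Fin m → ℝ) : ℂ := ∑ j, (y j : ℂ) * rootDir m (j : ℕ)

theorem fin_succ_ne {m : ℕ} [NeZero m] (hm : 3 ≤ m) (j : Fin m) : j ≠ j + 1 := by
  intro h
  have : (1 : Fin m) = 0 := by simpa using h.symm
  have := congrArg Fin.val this
  rw [Fin.val_one', Nat.mod_eq_of_lt (by lia)] at this
  simp at this

theorem coneMap_eq {m : ℕ} [NeZero m] (hm : 3 ≤ m) {y : Fin m → ℝ} {j : Fin m}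
    (hy : ∀ i, y i ≠ 0 → i = j ∨ i = j + 1) :
    coneMap m y = y j * rootDir m (j : ℕ) + y (j + 1) * rootDir m ((j : ℕ) + 1) := by
  unfold coneMap
  rw [← Finset.sum_subset (Finset.subset_univ {j, j + 1}), Finset.sum_pair (fin_succ_ne hm j),
    rootDir_fin_succ]
  intro i _ hi
  have : y i = 0 := by
    by_contra h
    simpa using hi (by simpa using hy i h)
  simp [this]

/-- A non-zero point of the cone has a representation with non-zero leading coordinate. -/
theorem cycleCone_leading {m : ℕ} [NeZero m] {y : Fin m → ℝ} (hy : y ∈ cycleCone m)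
    (h0 : y ≠ 0) : ∃ j, 0 < y j ∧ ∀ i, y i ≠ 0 → i = j ∨ i = j + 1 := by
  obtain ⟨hnn, j, hj⟩ := hy
  by_cases h : y j = 0
  · refine ⟨j + 1, ?_, fun i hi => ?_⟩
    · refine lt_of_le_of_ne (hnn _) fun h' => h0 ?_
      funext i
      by_contra hi
      rcases hj i hi with rfl | rfl
      · exact hi h
      · exact hi h'.symm
    · rcases hj i hi with rfl | rfl
      · exact absurd h hi
      · exact Or.inl rfl
  · exact ⟨j, lt_of_le_of_ne (hnn _) (Ne.symm h), hj⟩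

theorem norm_le_coneMap {m : ℕ} [NeZero m] (hm : 3 ≤ m) {y : Fin m → ℝ} (hy : y ∈ cycleCone m) :
    ‖y‖ ≤ 2 * ‖coneMap m y‖ := by
  obtain ⟨hnn, j, hj⟩ := hy
  have h := sq_norm_sector hm (j : ℕ) (hnn j) (hnn (j + 1))
  rw [← coneMap_eq hm hj] at h
  rw [pi_norm_le_iff_of_nonneg (by positivity)]
  intro i
  rw [Real.norm_eq_abs, abs_of_nonneg (hnn i)]
  by_cases hi : y i = 0
  · rw [hi]; positivity
  · refine (sq_le_sq₀ (hnn i) (by positivity)).1 ?_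
    have := sq_nonneg ‖coneMap m y‖
    rcases hj i hi with rfl | rfl
    · nlinarith [sq_nonneg (y (i + 1))]
    · nlinarith [sq_nonneg (y j)]

/-- The norm bound isolates the apex. Other points have a positive leading coordinate, so equal
images lie in the same half-open sector, where the two directions are independent because `sin
(2π/m) ≠ 0`. -/
theorem coneMap_injOn {m : ℕ} [NeZero m] (hm : 3 ≤ m) : Set.InjOn (coneMap m) (cycleCone m) := by
  intro y hy y' hy' h
  have zero_of : ∀ {x : Fin m → ℝ}, x ∈ cycleCone m → coneMap m x = 0 → x = 0 := by
    intro x hx hx0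
    have := norm_le_coneMap hm hx
    rw [hx0, norm_zero, mul_zero] at this
    exact norm_le_zero_iff.1 this
  have c0 : coneMap m 0 = 0 := by simp [coneMap]
  by_cases h0 : y = 0
  · subst h0
    rw [c0] at h
    exact (zero_of hy' h.symm).symm
  by_cases h0' : y' = 0
  · subst h0'
    rw [c0] at h
    exact zero_of hy h
  obtain ⟨j, hj, hjs⟩ := cycleCone_leading hy h0
  obtain ⟨k, hk, hks⟩ := cycleCone_leading hy' h0'
  have e := h
  rw [coneMap_eq hm hjs, coneMap_eq hm hks] at e
  have hjk : j = k :=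
    Fin.ext (sector_index_unique hm j.2 k.2 hj (hy.1 _) hk (hy'.1 _) e)
  subst hjk
  have e' : ((y j : ℂ) - y' j) + (y (j + 1) - y' (j + 1)) * rootDir m 1 = 0 := by
    have hne : rootDir m (j : ℕ) ≠ 0 := by
      rw [← norm_ne_zero_iff, norm_rootDir]; exact one_ne_zero
    apply mul_left_cancel₀ hne
    rw [rootDir_add] at e
    linear_combination e
  have him := congrArg Complex.im e'
  have hre := congrArg Complex.re e'
  rw [← Complex.ofReal_sub, ← Complex.ofReal_sub] at him hre
  simp only [add_im, add_re, ofReal_im, ofReal_re, im_ofReal_mul, re_ofReal_mul, rootDir_im,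
    zero_add, Int.cast_one, mul_one, zero_im, zero_re] at him hre
  have b1 : y (j + 1) - y' (j + 1) = 0 :=
    (mul_eq_zero.1 him).resolve_right (sin_angle_pos hm).ne'
  have b0 : y j - y' j = 0 := by simpa [b1] using hre
  funext i
  by_cases hi : i = j
  · subst hi; linarith
  by_cases hi' : i = j + 1
  · subst hi'; linarith
  have z1 : y i = 0 := by by_contra h; simpa [hi, hi'] using hjs i h
  have z2 : y' i = 0 := by by_contra h; simpa [hi, hi'] using hks i h
  rw [z1, z2]

theorem exists_coneMap_eq {m : ℕ} [NeZero m] (hm : 3 ≤ m) (z : ℂ) :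
    ∃ y ∈ cycleCone m, coneMap m y = z := by
  obtain ⟨j, hj, s, t, hs, ht, rfl⟩ := exists_mem_sector hm z
  have hne := fin_succ_ne hm ⟨j, hj⟩
  have hsupp : ∀ i, (Pi.single ⟨j, hj⟩ s + Pi.single (⟨j, hj⟩ + 1) t : Fin m → ℝ) i ≠ 0 →
      i = ⟨j, hj⟩ ∨ i = ⟨j, hj⟩ + 1 := by
    intro i hi
    by_contra hcon
    push Not at hcon
    exact hi (by simp [Pi.single_eq_of_ne hcon.1, Pi.single_eq_of_ne hcon.2])
  refine ⟨Pi.single ⟨j, hj⟩ s + Pi.single (⟨j, hj⟩ + 1) t, ⟨fun i => ?_, ⟨j, hj⟩, hsupp⟩, ?_⟩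
  · have h1 : (0 : Fin m → ℝ) ≤ Pi.single ⟨j, hj⟩ s := Pi.single_nonneg.2 hs
    have h2 : (0 : Fin m → ℝ) ≤ Pi.single (⟨j, hj⟩ + 1) t := Pi.single_nonneg.2 ht
    exact add_nonneg (h1 i) (h2 i)
  · rw [coneMap_eq hm hsupp]
    simp [Pi.single_eq_of_ne hne, Pi.single_eq_of_ne hne.symm]

theorem isClosed_cycleCone (m : ℕ) [NeZero m] : IsClosed (cycleCone m) := by
  have : cycleCone m = {y | ∀ i, 0 ≤ y i} ∩
      ⋃ j, {y : Fin m → ℝ | ∀ i, ¬(i = j ∨ i = j + 1) → y i = 0} := by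
    ext y
    simp only [cycleCone, Set.mem_ofPred_eq, Set.mem_inter_iff, Set.mem_iUnion]
    refine and_congr_right fun _ => exists_congr fun j => forall_congr' fun i => ?_
    tauto
  rw [this]
  refine IsClosed.inter ?_ (isClosed_iUnion_of_finite fun j => ?_)
  · simp only [Set.ofPred_forall]
    exact isClosed_iInter fun i => isClosed_le continuous_const (continuous_apply i)
  · simp only [Set.ofPred_forall]
    exact isClosed_iInter fun i => isClosed_iInter fun _ =>
      isClosed_eq (continuous_apply i) continuous_const

theorem continuous_coneMap (m : ℕ) : Continuous (coneMap m) :=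
  continuous_finsetSum _ fun j _ =>
    (Complex.continuous_ofReal.comp (continuous_apply j)).mul continuous_const

/-- The cone over a cycle is homeomorphic to the plane. -/
noncomputable def cycleConeHomeomorph {m : ℕ} [NeZero m] (hm : 3 ≤ m) : cycleCone m ≃ₜ ℂ :=
  Equiv.toHomeomorphOfContinuousClosed
    (Equiv.ofBijective (fun y : cycleCone m => coneMap m y.1)
      ⟨fun a b h => Subtype.ext (coneMap_injOn hm a.2 b.2 h), fun z => by
        obtain ⟨y, hy, h⟩ := exists_coneMap_eq hm z
        exact ⟨⟨y, hy⟩, h⟩⟩)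
    ((continuous_coneMap m).comp continuous_subtype_val)
    (by
      -- Continuity of the inverse: by `norm_le_coneMap` the map is proper, hence closed.
      have : IsProperMap fun y : cycleCone m => coneMap m y.1 := by
        rw [isProperMap_iff_tendsto_cocompact]
        refine ⟨(continuous_coneMap m).comp continuous_subtype_val, ?_⟩
        rw [← Metric.cobounded_eq_cocompact (α := ℂ), ← tendsto_norm_atTop_iff_cobounded]
        have h1 : Filter.Tendsto (fun y : cycleCone m => ‖y.1‖ / 2)
            (Filter.cocompact _) Filter.atTop :=
          ((tendsto_norm_cocompact_atTop).comp
            (isClosed_cycleCone m).isClosedEmbedding_subtypeVal.tendsto_cocompact).atTop_div_const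
            (by norm_num)
        refine Filter.tendsto_atTop_mono (fun y => ?_) h1
        have := norm_le_coneMap hm y.2
        linarith
      exact this.isClosedMap)

end SurfaceMaps

/-! ### Charts from vertex links, and connectedness of the carrier. -/

namespace SurfaceMaps

theorem nonempty_chartedSpace_of_forall {H M : Type} [TopologicalSpace H] [TopologicalSpace M]
    (h : ∀ x : M, ∃ U : Set M, IsOpen U ∧ x ∈ U ∧ Nonempty (U ≃ₜ H)) :
    Nonempty (ChartedSpace H M) := by
  choose U hU hx e using h
  let c : M → OpenPartialHomeomorph M H := fun x =>
    haveI : Nonempty (U x) := ⟨⟨x, hx x⟩⟩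
    (OpenPartialHomeomorph.symm
      (TopologicalSpace.Opens.openPartialHomeomorphSubtypeCoe ⟨U x, hU x⟩ ⟨⟨x, hx x⟩⟩)).trans
      (e x).some.toOpenPartialHomeomorph
  exact ⟨{ atlas := Set.range c
           chartAt := c
           mem_chart_source := fun x => by simp [c, hx]
           chart_mem_atlas := fun x => ⟨x, rfl⟩ }⟩

section

variable {V : Type} [Fintype V] [DecidableEq V] {K : AbstractSimplicialComplex V}

/-- The link of the vertex `v` is the cycle `w 0, …, w (m - 1)`. -/
structure IsCycleLink (K : AbstractSimplicialComplex V) (v : V) (m : ℕ) [NeZero m]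
    (w : Fin m → V) : Prop where
  injective : Function.Injective w
  ne : ∀ j, w j ≠ v
  mem_faces : ∀ s : Finset V, v ∈ s → (s ∈ K.faces ↔ ∃ j, s ⊆ {v, w j, w (j + 1)})

theorem exists_pos_of_mem_carrier {x : V → ℝ} (hx : x ∈ carrier K) : ∃ v, 0 < x v := by
  by_contra! h
  have h1 := hx.1.2
  have : ∑ v, x v ≤ 0 := Finset.sum_nonpos fun v _ => h v
  linarith

namespace IsCycleLink

variable {v : V} {m : ℕ} [NeZero m] {w : Fin m → V}

theorem exists_index (h : IsCycleLink K v m w) {x : V → ℝ} (hx : x ∈ carrier K) (hv : 0 < x v) :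
    ∃ j, ∀ u, x u ≠ 0 → u = v ∨ u = w j ∨ u = w (j + 1) := by
  obtain ⟨j, hj⟩ := (h.mem_faces _ (by simpa using hv.ne')).1 hx.2
  refine ⟨j, fun u hu => ?_⟩
  simpa using hj (by simpa using hu : u ∈ Finset.univ.filter fun v => x v ≠ 0)

theorem sum_eq (h : IsCycleLink K v m w) {x : V → ℝ} (hx : ∀ u, u ≠ v → (∀ j, w j ≠ u) → x u = 0) :
    ∑ u, x u = x v + ∑ j, x (w j) := by
  have hv : v ∉ Finset.univ.image w := by simpa using h.ne
  rw [← Finset.sum_image (f := x) (g := w) (s := Finset.univ) (fun a _ b _ e => h.injective e),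
    ← Finset.sum_insert hv]
  symm
  apply Finset.sum_subset (Finset.subset_univ _)
  intro u _ hu
  simp only [Finset.mem_insert, Finset.mem_image, Finset.mem_univ, true_and, not_or,
    not_exists] at hu
  exact hx u hu.1 hu.2

/-- The quotients of the link coordinates by the coordinate of the centre. -/
noncomputable def toCone (v : V) (w : Fin m → V) (x : V → ℝ) : Fin m → ℝ := fun j => x (w j) / x v

/-- The point of the open star with given link coordinates relative to the centre. -/
noncomputable def ofCone (v : V) (w : Fin m → V) (y : Fin m → ℝ) : V → ℝ := fun u =>
  (if u = v then 1 else ∑ j, if w j = u then y j else 0) / (1 + ∑ j, y j)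

theorem toCone_mem (h : IsCycleLink K v m w) {x : V → ℝ} (hx : x ∈ carrier K) (hv : 0 < x v) :
    toCone v w x ∈ cycleCone m := by
  obtain ⟨j, hj⟩ := h.exists_index hx hv
  refine ⟨fun i => div_nonneg (hx.1.1 _) hv.le, j, fun i hi => ?_⟩
  have hi' : x (w i) ≠ 0 := fun h0 => hi (by simp [toCone, h0])
  rcases hj _ hi' with e | e | e
  · exact absurd e (h.ne i)
  · exact Or.inl (h.injective e)
  · exact Or.inr (h.injective e)

theorem ofCone_center (y : Fin m → ℝ) : ofCone v w y v = 1 / (1 + ∑ j, y j) := by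
  simp [ofCone]

theorem ofCone_link (h : IsCycleLink K v m w) (y : Fin m → ℝ) (j : Fin m) :
    ofCone v w y (w j) = y j / (1 + ∑ j, y j) := by
  simp [ofCone, h.ne, h.injective.eq_iff]

theorem ofCone_other (y : Fin m → ℝ) {u : V} (hu : u ≠ v) (hu' : ∀ j, w j ≠ u) :
    ofCone v w y u = 0 := by
  simp [ofCone, hu, hu']

theorem ofCone_mem (h : IsCycleLink K v m w) {y : Fin m → ℝ} (hy : y ∈ cycleCone m) :
    ofCone v w y ∈ carrier K ∧ 0 < ofCone v w y v := by
  obtain ⟨hnn, j, hj⟩ := hy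
  have hs : 0 ≤ ∑ j, y j := Finset.sum_nonneg fun i _ => hnn i
  have hpos : 0 < ofCone v w y v := by rw [ofCone_center]; positivity
  refine ⟨⟨⟨fun u => ?_, ?_⟩, ?_⟩, hpos⟩
  · refine div_nonneg ?_ (by positivity)
    split_ifs
    · exact zero_le_one
    · exact Finset.sum_nonneg fun i _ => by split_ifs <;> simp [hnn]
  · rw [h.sum_eq (fun u hu hu' => ofCone_other y hu hu'), ofCone_center]
    simp only [h.ofCone_link]
    rw [← Finset.sum_div, ← add_div, div_self (by positivity)]
  · rw [h.mem_faces _ (by simpa using hpos.ne')]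
    refine ⟨j, fun u hu => ?_⟩
    have hu0 : ofCone v w y u ≠ 0 := by simpa using hu
    by_cases huv : u = v
    · simp [huv]
    by_cases hw : ∃ i, w i = u
    · obtain ⟨i, rfl⟩ := hw
      have : y i ≠ 0 := fun h0 => hu0 (by rw [h.ofCone_link, h0, zero_div])
      rcases hj i this with rfl | rfl <;> simp
    · push Not at hw
      exact absurd (ofCone_other y huv hw) hu0

theorem toCone_ofCone (h : IsCycleLink K v m w) {y : Fin m → ℝ} (hy : y ∈ cycleCone m) :
    toCone v w (ofCone v w y) = y := by
  have hs : 0 ≤ ∑ j, y j := Finset.sum_nonneg fun i _ => hy.1 i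
  funext j
  rw [toCone, h.ofCone_link, ofCone_center]
  field_simp

theorem ofCone_toCone (h : IsCycleLink K v m w) {x : V → ℝ} (hx : x ∈ carrier K) (hv : 0 < x v) :
    ofCone v w (toCone v w x) = x := by
  obtain ⟨j, hj⟩ := h.exists_index hx hv
  have h0 : ∀ u, u ≠ v → (∀ j, w j ≠ u) → x u = 0 := by
    intro u hu hu'
    by_contra hne
    rcases hj u hne with e | e | e
    · exact hu e
    · exact hu' _ e.symm
    · exact hu' _ e.symm
  have hsum : 1 + ∑ j, toCone v w x j = 1 / x v := by
    have := h.sum_eq h0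
    rw [hx.1.2] at this
    simp only [toCone]
    rw [← Finset.sum_div, show ∑ j, x (w j) = 1 - x v by linarith, eq_div_iff hv.ne', add_mul,
      div_mul_cancel₀ _ hv.ne']
    ring
  funext u
  by_cases huv : u = v
  · rw [huv, ofCone_center, hsum, one_div_one_div]
  by_cases hw : ∃ i, w i = u
  · obtain ⟨i, rfl⟩ := hw
    rw [h.ofCone_link, hsum, toCone]
    field_simp
  · push Not at hw
    rw [ofCone_other _ huv hw, h0 u huv hw]

/-- The open star of a vertex is homeomorphic to the cone over its link. -/
noncomputable def openStarHomeomorph (h : IsCycleLink K v m w) :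
    {x : carrier K | 0 < x.1 v} ≃ₜ cycleCone m where
  toFun x := ⟨toCone v w x.1.1, h.toCone_mem x.1.2 x.2⟩
  invFun y := ⟨⟨ofCone v w y.1, (h.ofCone_mem y.2).1⟩, (h.ofCone_mem y.2).2⟩
  left_inv x := Subtype.ext (Subtype.ext (h.ofCone_toCone x.1.2 x.2))
  right_inv y := Subtype.ext (h.toCone_ofCone y.2)
  continuous_toFun := by
    refine Continuous.subtype_mk (continuous_pi fun j => ?_) _
    have hc : ∀ u : V, Continuous fun x : {x : carrier K | 0 < x.1 v} => x.1.1 u := fun u =>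
      (continuous_apply u).comp (continuous_subtype_val.comp continuous_subtype_val)
    exact (hc _).div (hc _) fun x => ne_of_gt x.2
  continuous_invFun := by
    refine Continuous.subtype_mk (Continuous.subtype_mk (continuous_pi fun u => ?_) _) _
    have hc : ∀ j, Continuous fun y : cycleCone m => y.1 j := fun j =>
      (continuous_apply j).comp continuous_subtype_val
    refine Continuous.div ?_ (continuous_const.add (continuous_finsetSum _ fun j _ => hc j)) ?_
    · split_ifs
      · exact continuous_const
      · refine continuous_finsetSum _ fun j _ => ?_
        split_ifs
        · exact hc j
        · exact continuous_const
    · intro y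
      have hs : 0 ≤ ∑ j, y.1 j := Finset.sum_nonneg fun i _ => y.2.1 i
      positivity

end IsCycleLink

/-- A complex all of whose vertex links are cycles is a topological surface. -/
theorem nonempty_chartedSpace_carrier
    (h : ∀ v, ∃ n, ∃ w : Fin (n + 3) → V, IsCycleLink K v (n + 3) w) :
    Nonempty (ChartedSpace (EuclideanSpace ℝ (Fin 2)) (carrier K)) := by
  apply nonempty_chartedSpace_of_forall
  rintro ⟨x, hx⟩
  obtain ⟨v, hv⟩ := exists_pos_of_mem_carrier hx
  obtain ⟨n, w, hw⟩ := h v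
  refine ⟨{x | 0 < x.1 v}, ?_, hv, ⟨hw.openStarHomeomorph.trans
    ((cycleConeHomeomorph (by lia)).trans
      Complex.orthonormalBasisOneI.repr.toHomeomorph)⟩⟩
  exact isOpen_lt continuous_const ((continuous_apply v).comp continuous_subtype_val)

theorem segment_subset_carrier {x y : V → ℝ} (hx : x ∈ carrier K) (hy : y ∈ carrier K)
    {s : Finset V} (hs : s ∈ K.faces) (hxs : ∀ v, x v ≠ 0 → v ∈ s) (hys : ∀ v, y v ≠ 0 → v ∈ s) :
    segment ℝ x y ⊆ carrier K := by
  intro z hz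
  have hz1 : z ∈ stdSimplex ℝ V := (convex_stdSimplex ℝ V).segment_subset hx.1 hy.1 hz
  refine ⟨hz1, ?_⟩
  obtain ⟨a, b, ha, hb, hab, rfl⟩ := hz
  refine (K.isRelLowerSet_faces hs).2 ?_ ?_
  · intro v hv
    by_contra hvs
    have h1 : x v = 0 := by by_contra h; exact hvs (hxs v h)
    have h2 : y v = 0 := by by_contra h; exact hvs (hys v h)
    simp [h1, h2] at hv
  · by_contra hne
    rw [Finset.not_nonempty_iff_eq_empty, Finset.filter_eq_empty_iff] at hne
    have : ∑ v, (a • x + b • y) v = 0 := Finset.sum_eq_zero fun v hv => by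
      have := hne hv
      simpa using this
    rw [hz1.2] at this
    exact one_ne_zero this

theorem single_mem_carrier (v : V) : (Pi.single v 1 : V → ℝ) ∈ carrier K := by
  refine ⟨single_mem_stdSimplex ℝ v, ?_⟩
  have : (Finset.univ.filter fun u => (Pi.single v 1 : V → ℝ) u ≠ 0) = {v} := by
    ext u
    simp [Pi.single_apply]
  rw [this]
  exact K.singleton_mem v

/-- A complex in which some vertex is adjacent to all others has a connected carrier. -/
theorem connectedSpace_carrier {c : V} (h : ∀ v, v ≠ c → {c, v} ∈ K.faces) :
    ConnectedSpace (carrier K) := by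
  rw [← isConnected_iff_connectedSpace]
  apply IsPathConnected.isConnected
  refine ⟨Pi.single c 1, single_mem_carrier c, fun {x} hx => ?_⟩
  obtain ⟨v, hv⟩ := exists_pos_of_mem_carrier hx
  -- Each point is joined inside its own simplex to a vertex of that simplex, and this vertex along
  -- an edge to `c`.
  have h1 : JoinedIn (carrier K) (Pi.single v 1) x := by
    apply JoinedIn.of_segment_subset
    refine segment_subset_carrier (single_mem_carrier v) hx hx.2 ?_ (by simp)
    intro u hu
    have : u = v := by
      by_contra hne
      exact hu (Pi.single_eq_of_ne hne _)
    subst this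
    simpa using hv.ne'
  by_cases hvc : v = c
  · subst hvc; exact h1
  · refine JoinedIn.trans (JoinedIn.of_segment_subset ?_) h1
    refine segment_subset_carrier (single_mem_carrier c) (single_mem_carrier v) (h v hvc) ?_ ?_
    · intro u hu
      by_contra hne
      simp only [Finset.mem_insert, Finset.mem_singleton, not_or] at hne
      exact hu (Pi.single_eq_of_ne hne.1 _)
    · intro u hu
      by_contra hne
      simp only [Finset.mem_insert, Finset.mem_singleton, not_or] at hne
      exact hu (Pi.single_eq_of_ne hne.2 _)

end

end SurfaceMaps

/-! ### Combinatorics of oriented triangulations: links and face numbers. -/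

namespace SurfaceMaps
open Relation

section

variable {V F : Type} [Fintype V] [DecidableEq V] [Fintype F] [DecidableEq F]

/-- For corners `(f, k)` of oriented triangles `f` with vertices `p f 0, p f 1, p f 2`:
the corner `d'` follows `d` in the rotation around their common vertex. -/
def LinkStep (p : F → Fin 3 → V) (d d' : F × Fin 3) : Prop :=
  p d'.1 d'.2 = p d.1 d.2 ∧ p d'.1 (d'.2 + 1) = p d.1 (d.2 + 2)

/-- The complex `K` is generated by the oriented triangles `p f`, `f : F`, which fit together to a
closed oriented surface: every directed edge lies in exactly one of them, the directed edges come
in opposite pairs, the triangles around a vertex form a single cycle, and one vertex is adjacent to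
all others. -/
structure IsOrientedTriangulation (K : AbstractSimplicialComplex V) (p : F → Fin 3 → V) :
    Prop where
  mem_faces : ∀ s, s ∈ K.faces ↔ s.Nonempty ∧ ∃ f, s ⊆ Finset.univ.image (p f)
  ne : ∀ f k, p f k ≠ p f (k + 1)
  edge_inj : ∀ f f' k k', p f k = p f' k' → p f (k + 1) = p f' (k' + 1) → f = f' ∧ k = k'
  exists_rev : ∀ f k, ∃ f' k', p f' k' = p f (k + 1) ∧ p f' (k' + 1) = p f k ∧
    p f' (k' + 2) ≠ p f (k + 2)
  link : ∀ v, ∃ d : F × Fin 3, p d.1 d.2 = v ∧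
    ∀ d' : F × Fin 3, p d'.1 d'.2 = v → ReflTransGen (LinkStep p) d d'
  hub : ∃ c, ∀ v, v ≠ c → ∃ f k, p f k = c ∧ p f (k + 1) = v

theorem fin3_add_one_one (k : Fin 3) : k + 1 + 1 = k + 2 := by revert k; decide
theorem fin3_add_one_two (k : Fin 3) : k + 1 + 2 = k := by revert k; decide
theorem fin3_add_two_one (k : Fin 3) : k + 2 + 1 = k := by revert k; decide
theorem fin3_add_two_two (k : Fin 3) : k + 2 + 2 = k + 1 := by revert k; decide

theorem fin3_cases (a b : Fin 3) (h : a ≠ b) : b = a + 1 ∨ a = b + 1 := by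
  revert a b; decide

theorem fin3_third (a b c : Fin 3) (h : a ≠ b) (h' : c ≠ a) (h'' : c ≠ b) :
    b = a + 1 ∧ c = a + 2 ∨ a = b + 1 ∧ c = b + 2 := by
  revert a b c; decide

theorem fin3_eq (k i : Fin 3) : i = k ∨ i = k + 1 ∨ i = k + 2 := by
  revert k i; decide

theorem sign_addRight_fin3 (k : Fin 3) : Equiv.Perm.sign (Equiv.addRight k) = 1 := by
  revert k; decide

namespace IsOrientedTriangulation

variable {K : AbstractSimplicialComplex V} {p : F → Fin 3 → V}

section Combinatorics

variable (h : IsOrientedTriangulation K p)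
include h

theorem corner_injective (f : F) : Function.Injective (p f) := by
  intro a b hab
  by_contra hne
  rcases fin3_cases a b hne with rfl | rfl
  · exact h.ne f a hab
  · exact h.ne f b hab.symm

theorem third_ne {f f' : F} {k k' : Fin 3} (h1 : p f' k' = p f (k + 1))
    (h2 : p f' (k' + 1) = p f k) : p f' (k' + 2) ≠ p f (k + 2) := by
  obtain ⟨g, l, g1, g2, g3⟩ := h.exists_rev f k
  obtain ⟨rfl, rfl⟩ := h.edge_inj f' g k' l (h1.trans g1.symm) (h2.trans g2.symm)
  exact g3

/-- A triangle is determined by its vertices. -/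
theorem eq_of_comp {f f' : F} {σ : Fin 3 → Fin 3} (hσ : p f = p f' ∘ σ) : f = f' := by
  have hinj : Function.Injective σ := fun a b hab =>
    h.corner_injective f (by rw [hσ]; simp [hab])
  have e : ∀ i, p f i = p f' (σ i) := fun i => congrFun hσ i
  -- If `σ` is a rotation the triangles share a directed edge. If it reverses orientation they lie
  -- on the two sides of an edge with equal third vertices, which `exists_rev` forbids.
  rcases fin3_third (σ 0) (σ 1) (σ 2) (hinj.ne (by decide)) (hinj.ne (by decide))
    (hinj.ne (by decide)) with ⟨h1, -⟩ | ⟨h1, h2⟩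
  · exact (h.edge_inj f f' 0 (σ 0) (e 0) (by rw [← h1]; exact e 1)).1
  · exact absurd (h2 ▸ (e 2).symm) (h.third_ne (f := f) (k := 0) (e 1).symm (by
      rw [← h1]; exact (e 0).symm))

theorem exists_perm {f : F} {t : Fin 3 → V} (ht : Function.Injective t)
    (hf : Finset.univ.image t ⊆ Finset.univ.image (p f)) :
    ∃ π : Equiv.Perm (Fin 3), t = p f ∘ π := by
  have : ∀ i, ∃ j, p f j = t i := fun i => by
    simpa using hf (Finset.mem_image_of_mem t (Finset.mem_univ i))
  choose σ hσ using this
  have hinj : Function.Injective σ := fun a b hab => ht (by rw [← hσ, ← hσ, hab])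
  exact ⟨Equiv.ofBijective σ (Finite.injective_iff_bijective.1 hinj), by
    funext i; exact (hσ i).symm⟩

theorem eq_of_image_subset {f f' : F}
    (hf : Finset.univ.image (p f) ⊆ Finset.univ.image (p f')) : f = f' := by
  obtain ⟨π, hπ⟩ := h.exists_perm (h.corner_injective f) hf
  exact h.eq_of_comp hπ

theorem image_mem_faces (f : F) : Finset.univ.image (p f) ∈ K.faces :=
  (h.mem_faces _).2 ⟨Finset.univ_nonempty.image _, f, subset_rfl⟩

theorem card_image (f : F) : (Finset.univ.image (p f)).card = 3 := by
  rw [Finset.card_image_of_injective _ (h.corner_injective f)]; rfl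

/-- Any edge, in either direction, is a directed edge of exactly one oriented triangle. -/
theorem exists_dart {s : Finset V} (hs : s ∈ K.faces) {u w : V} (hu : u ∈ s) (hw : w ∈ s)
    (huw : u ≠ w) : ∃ f k, p f k = u ∧ p f (k + 1) = w := by
  obtain ⟨-, f, hf⟩ := (h.mem_faces s).1 hs
  obtain ⟨a, rfl⟩ : ∃ a, p f a = u := by simpa using hf hu
  obtain ⟨b, rfl⟩ : ∃ b, p f b = w := by simpa using hf hw
  rcases fin3_cases a b (fun e => huw (by rw [e])) with rfl | rfl
  · exact ⟨f, a, rfl, rfl⟩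
  · obtain ⟨f', k', h1, h2, -⟩ := h.exists_rev f b
    exact ⟨f', k', h1, h2⟩

/-- The two triangles at an edge. -/
theorem eq_third_of_mem_faces {f f' : F} {k k' : Fin 3} (h1 : p f' k' = p f (k + 1))
    (h2 : p f' (k' + 1) = p f k) {x : V} (hx : x ≠ p f k) (hx' : x ≠ p f (k + 1))
    {s : Finset V} (hs : s ∈ K.faces) (hxs : x ∈ s) (hks : p f k ∈ s) (hks' : p f (k + 1) ∈ s) :
    x = p f (k + 2) ∨ x = p f' (k' + 2) := by
  obtain ⟨-, g, hg⟩ := (h.mem_faces s).1 hs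
  obtain ⟨a, ha⟩ : ∃ a, p g a = p f k := by simpa using hg hks
  obtain ⟨b, hb⟩ : ∃ a, p g a = p f (k + 1) := by simpa using hg hks'
  obtain ⟨c, rfl⟩ : ∃ a, p g a = x := by simpa using hg hxs
  rcases fin3_third a b c (fun e => h.ne f k (by rw [← ha, ← hb, e]))
    (fun e => hx (by rw [← ha, e])) (fun e => hx' (by rw [← hb, e])) with ⟨rfl, rfl⟩ | ⟨rfl, rfl⟩
  · obtain ⟨rfl, rfl⟩ := h.edge_inj _ _ _ _ ha hb
    exact Or.inl rfl
  · obtain ⟨rfl, rfl⟩ := h.edge_inj _ _ _ _ (hb.trans h1.symm) (ha.trans h2.symm)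
    exact Or.inr rfl

theorem exists_next (d : F × Fin 3) : ∃ d', LinkStep p d d' := by
  obtain ⟨f', k', h1, h2, -⟩ := h.exists_rev d.1 (d.2 + 2)
  rw [fin3_add_two_one] at h1
  exact ⟨(f', k'), h1, h2⟩

theorem linkStep_unique {d d₁ d₂ : F × Fin 3} (h1 : LinkStep p d d₁) (h2 : LinkStep p d d₂) :
    d₁ = d₂ := by
  obtain ⟨e1, e2⟩ := h.edge_inj d₁.1 d₂.1 d₁.2 d₂.2 (h1.1.trans h2.1.symm) (h1.2.trans h2.2.symm)
  exact Prod.ext e1 e2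

theorem linkStep_left_unique {d d₁ d₂ : F × Fin 3} (h1 : LinkStep p d₁ d) (h2 : LinkStep p d₂ d) :
    d₁ = d₂ := by
  obtain ⟨e1, e2⟩ := h.edge_inj d₁.1 d₂.1 (d₁.2 + 2) (d₂.2 + 2) (h1.2.symm.trans h2.2) (by
    rw [fin3_add_two_one, fin3_add_two_one]; exact h1.1.symm.trans h2.1)
  exact Prod.ext e1 (add_right_cancel e2)

theorem linkStep_third_ne {d d' : F × Fin 3} (h1 : LinkStep p d d') :
    p d'.1 (d'.2 + 2) ≠ p d.1 (d.2 + 1) := by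
  rw [← fin3_add_two_two d.2]
  exact h.third_ne (by rw [fin3_add_two_one]; exact h1.1) h1.2

/-- The rotation is an injective self-map of the finite set of corners, and the corners at `v` form
one of its orbits. The link lists the vertices following `v` in the successive triangles; they are
distinct because a directed edge lies in only one triangle. -/
theorem exists_cycleLink (v : V) : ∃ n, ∃ w : Fin (n + 3) → V, IsCycleLink K v (n + 3) w := by
  choose rot hrot using h.exists_next
  have hinj : Function.Injective rot := fun a b hab =>
    h.linkStep_left_unique (hrot a) (hab ▸ hrot b)
  obtain ⟨d, hd, hall⟩ := h.link v
  have hsrc : ∀ j, p (rot^[j] d).1 (rot^[j] d).2 = v := by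
    intro j
    induction j with
    | zero => exact hd
    | succ j ih => rw [Function.iterate_succ_apply']; exact (hrot _).1.trans ih
  have hreach : ∀ d' : F × Fin 3, p d'.1 d'.2 = v → ∃ j, rot^[j] d = d' := by
    intro d' hd'
    have := hall d' hd'
    clear hd'
    induction this with
    | refl => exact ⟨0, rfl⟩
    | tail _ hstep ih =>
      obtain ⟨j, rfl⟩ := ih
      exact ⟨j + 1, by
        rw [Function.iterate_succ_apply']; exact h.linkStep_unique (hrot _) hstep⟩
  have hper : d ∈ Function.periodicPts rot := hinj.mem_periodicPts d
  set m := Function.minimalPeriod rot d with hm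
  have hm0 : 0 < m := Function.minimalPeriod_pos_of_mem_periodicPts hper
  have hmper : rot^[m] d = d := Function.iterate_minimalPeriod
  -- Period one would identify two vertices of a triangle, and period two would give both triangles
  -- at an edge the same third vertex. So the cycle has length at least three.
  have hm1 : m ≠ 1 := by
    intro h1
    rw [h1, Function.iterate_one] at hmper
    have := (hrot d).2
    rw [hmper, ← fin3_add_one_one] at this
    exact h.ne _ _ this
  have hm2 : m ≠ 2 := by
    intro h2
    rw [h2, Function.iterate_succ_apply, Function.iterate_one] at hmper
    have := (hrot (rot d)).2
    rw [hmper] at this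
    exact h.linkStep_third_ne (hrot d) this.symm
  obtain ⟨n, hn⟩ : ∃ n, m = n + 3 := ⟨m - 3, by lia⟩
  have hmod : ∀ i, rot^[i % (n + 3)] d = rot^[i] d := fun i => by
    rw [← hn, hm, Function.iterate_mod_minimalPeriod_eq]
  let w : Fin (n + 3) → V := fun j => p (rot^[j] d).1 ((rot^[j] d).2 + 1)
  have hw1 : ∀ j : Fin (n + 3), w (j + 1) = p (rot^[j] d).1 ((rot^[j] d).2 + 2) := by
    intro j
    have e : rot^[((j + 1 : Fin (n + 3)) : ℕ)] d = rot^[(j : ℕ) + 1] d := by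
      rw [Fin.val_add, Fin.val_one]
      exact hmod _
    show p (rot^[((j + 1 : Fin (n + 3)) : ℕ)] d).1 _ = _
    rw [e, Function.iterate_succ_apply']
    exact (hrot _).2
  have himg : ∀ j : Fin (n + 3),
      ({v, w j, w (j + 1)} : Finset V) = Finset.univ.image (p (rot^[j] d).1) := by
    intro j
    rw [hw1]
    ext x
    simp only [Finset.mem_insert, Finset.mem_singleton, Finset.mem_image, Finset.mem_univ,
      true_and]
    constructor
    · rintro (rfl | rfl | rfl)
      · exact ⟨_, hsrc j⟩
      · exact ⟨_, rfl⟩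
      · exact ⟨_, rfl⟩
    · rintro ⟨i, rfl⟩
      rcases fin3_eq (rot^[j] d).2 i with e | e | e
      · exact Or.inl (by rw [e]; exact hsrc j)
      · exact Or.inr (Or.inl (by rw [e]))
      · exact Or.inr (Or.inr (by rw [e]))
  refine ⟨n, w, ⟨?_, ?_, ?_⟩⟩
  · intro a b hab
    have e := h.edge_inj _ _ _ _ ((hsrc a).trans (hsrc b).symm) hab
    have e' : rot^[a] d = rot^[b] d := Prod.ext e.1 e.2
    refine Fin.ext (Function.iterate_injOn_Iio_minimalPeriod (f := rot) (x := d) ?_ ?_ e')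
    · rw [Set.mem_Iio, ← hm, hn]; exact a.2
    · rw [Set.mem_Iio, ← hm, hn]; exact b.2
  · intro j e
    exact h.ne (rot^[j] d).1 (rot^[j] d).2 (by rw [hsrc]; exact e.symm)
  · intro s hvs
    constructor
    · intro hs
      obtain ⟨-, f, hf⟩ := (h.mem_faces s).1 hs
      obtain ⟨k, hk⟩ : ∃ k, p f k = v := by simpa using hf hvs
      obtain ⟨j, hj⟩ := hreach (f, k) hk
      refine ⟨⟨j % (n + 3), Nat.mod_lt j (by lia)⟩, ?_⟩
      rw [himg]
      show s ⊆ Finset.univ.image (p (rot^[j % (n + 3)] d).1)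
      rw [hmod, hj]
      exact hf
    · rintro ⟨j, hj⟩
      rw [himg] at hj
      exact (h.mem_faces s).2 ⟨⟨v, hvs⟩, _, hj⟩

theorem faceCount_zero : faceCount K 0 = Fintype.card V := by
  have : {s ∈ K.faces | s.card = 0 + 1} = (fun v : V => ({v} : Finset V)) '' Set.univ := by
    ext s
    simp only [Set.mem_ofPred_eq, zero_add, Finset.card_eq_one, Set.image_univ, Set.mem_range]
    constructor
    · rintro ⟨-, v, rfl⟩; exact ⟨v, rfl⟩
    · rintro ⟨v, rfl⟩; exact ⟨K.singleton_mem v, v, rfl⟩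
  rw [faceCount, this, Set.ncard_image_of_injective _ Finset.singleton_injective, Set.ncard_univ,
    Nat.card_eq_fintype_card]

theorem faceCount_two : faceCount K 2 = Fintype.card F := by
  have : {s ∈ K.faces | s.card = 2 + 1} = (fun f : F => Finset.univ.image (p f)) '' Set.univ := by
    ext s
    simp only [Set.mem_ofPred_eq, Set.image_univ, Set.mem_range]
    constructor
    · rintro ⟨hs, hc⟩
      obtain ⟨-, f, hf⟩ := (h.mem_faces s).1 hs
      exact ⟨f, (Finset.eq_of_subset_of_card_le hf (by rw [h.card_image, hc])).symm⟩
    · rintro ⟨f, rfl⟩; exact ⟨h.image_mem_faces f, h.card_image f⟩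
  rw [faceCount, this, Set.ncard_image_of_injective _
    (fun f f' e => h.eq_of_image_subset (subset_of_eq e)), Set.ncard_univ,
    Nat.card_eq_fintype_card]

/-- Double counting: forgetting the direction maps the `3 |F|` directed edges two-to-one onto the
edges. -/
theorem two_mul_faceCount_one : 2 * faceCount K 1 = 3 * Fintype.card F := by
  let e : F × Fin 3 → Finset V := fun d => {p d.1 d.2, p d.1 (d.2 + 1)}
  have hset : {s ∈ K.faces | s.card = 1 + 1} = (Finset.univ.image e : Finset (Finset V)) := by
    ext s
    simp only [Set.mem_ofPred_eq, Finset.coe_image, Finset.coe_univ, Set.image_univ,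
      Set.mem_range]
    constructor
    · rintro ⟨hs, hc⟩
      obtain ⟨u, w, huw, rfl⟩ := Finset.card_eq_two.1 hc
      obtain ⟨f, k, rfl, rfl⟩ := h.exists_dart hs (u := u) (w := w) (by simp) (by simp) huw
      exact ⟨(f, k), rfl⟩
    · rintro ⟨⟨f, k⟩, rfl⟩
      refine ⟨(h.mem_faces _).2 ⟨⟨p f k, by simp [e]⟩, f, ?_⟩, Finset.card_pair (h.ne f k)⟩
      intro x hx
      simp only [e, Finset.mem_insert, Finset.mem_singleton] at hx
      rcases hx with rfl | rfl <;> simp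
  have hfib : ∀ b ∈ Finset.univ.image e, (Finset.univ.filter fun d => e d = b).card = 2 := by
    intro b hb
    obtain ⟨⟨f, k⟩, -, rfl⟩ := Finset.mem_image.1 hb
    obtain ⟨f', k', h1, h2, -⟩ := h.exists_rev f k
    have : (Finset.univ.filter fun d => e d = e (f, k)) = {(f, k), (f', k')} := by
      ext ⟨g, l⟩
      simp only [e, Finset.mem_filter, Finset.mem_univ, true_and, Finset.mem_insert,
        Finset.mem_singleton]
      constructor
      · intro he
        have a1 : p g l ∈ ({p f k, p f (k + 1)} : Finset V) := by rw [← he]; simp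
        have a2 : p g (l + 1) ∈ ({p f k, p f (k + 1)} : Finset V) := by rw [← he]; simp
        simp only [Finset.mem_insert, Finset.mem_singleton] at a1 a2
        rcases a1 with a1 | a1 <;> rcases a2 with a2 | a2
        · exact absurd (a1.trans a2.symm) (h.ne g l)
        · obtain ⟨rfl, rfl⟩ := h.edge_inj _ _ _ _ a1 a2
          exact Or.inl rfl
        · obtain ⟨rfl, rfl⟩ := h.edge_inj _ _ _ _ (a1.trans h1.symm) (a2.trans h2.symm)
          exact Or.inr rfl
        · exact absurd (a1.trans a2.symm) (h.ne g l)
      · rintro (hp | hp)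
        · obtain ⟨rfl, rfl⟩ := Prod.ext_iff.1 hp
          rfl
        · obtain ⟨rfl, rfl⟩ := Prod.ext_iff.1 hp
          rw [h1, h2, Finset.pair_comm]
    rw [this, Finset.card_pair]
    intro hp
    obtain ⟨rfl, rfl⟩ := Prod.ext_iff.1 hp
    exact h.ne f k h1
  have hcard := Finset.card_eq_sum_card_image e Finset.univ
  rw [Finset.sum_congr rfl hfib, Finset.sum_const, Finset.card_univ, Fintype.card_prod,
    Fintype.card_fin, smul_eq_mul] at hcard
  rw [faceCount, hset, Set.ncard_coe_finset]
  lia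

end Combinatorics

end IsOrientedTriangulation

end

end SurfaceMaps

/-! ### Orientation, fundamental class and degree. -/

namespace SurfaceMaps
open Relation

section

variable {V F : Type} [Fintype V] [DecidableEq V] [Fintype F] [DecidableEq F]

/-- The coefficients of the sum of all oriented triangles. -/
def fundamentalFun (p : F → Fin 3 → V) (t : Fin 3 → V) : ℤ :=
  ∑ f, ∑ π : Equiv.Perm (Fin 3), if t = p f ∘ π then (Equiv.Perm.sign π : ℤ) else 0

theorem fundamentalFun_comp (p : F → Fin 3 → V) (σ : Equiv.Perm (Fin 3)) (t : Fin 3 → V) :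
    fundamentalFun p (t ∘ σ) = (Equiv.Perm.sign σ : ℤ) * fundamentalFun p t := by
  unfold fundamentalFun
  rw [Finset.mul_sum]
  refine Finset.sum_congr rfl fun f _ => ?_
  rw [Finset.mul_sum, ← Equiv.sum_comp (Equiv.mulRight σ)]
  refine Finset.sum_congr rfl fun π _ => ?_
  have : (t ∘ σ = p f ∘ (Equiv.mulRight σ π)) ↔ t = p f ∘ π := by
    rw [Equiv.coe_mulRight, Equiv.Perm.coe_mul, ← Function.comp_assoc]
    exact σ.surjective.injective_comp_right.eq_iff
  rw [if_congr this rfl rfl]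
  split_ifs
  · simp [mul_comm]
  · simp

theorem exists_of_fundamentalFun_ne_zero {p : F → Fin 3 → V} {t : Fin 3 → V}
    (ht : fundamentalFun p t ≠ 0) : ∃ f, ∃ π : Equiv.Perm (Fin 3), t = p f ∘ π := by
  obtain ⟨f, -, hf⟩ := Finset.exists_ne_zero_of_sum_ne_zero ht
  obtain ⟨π, -, hπ⟩ := Finset.exists_ne_zero_of_sum_ne_zero hf
  exact ⟨f, π, by by_contra hne; exact hπ (if_neg hne)⟩

theorem image_comp_perm (q : Fin 3 → V) (π : Equiv.Perm (Fin 3)) :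
    Finset.univ.image (q ∘ π) = Finset.univ.image q := by
  ext x
  simp only [Finset.mem_image, Finset.mem_univ, true_and, Function.comp_apply]
  exact ⟨fun ⟨i, hi⟩ => ⟨_, hi⟩, fun ⟨i, hi⟩ => ⟨π.symm i, by simpa using hi⟩⟩

theorem cons_eq_comp_addRight (q : Fin 3 → V) (k : Fin 3) :
    (Fin.cons (q (k + 2)) ![q k, q (k + 1)] : Fin 3 → V) = q ∘ Equiv.addRight (k + 2) := by
  funext i
  fin_cases i
  · simp
  · show q k = q (1 + (k + 2))
    congr 1; revert k; decide
  · show q (k + 1) = q (2 + (k + 2))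
    congr 1; revert k; decide

theorem cons_swap_eq_comp (q : Fin 3 → V) (k : Fin 3) :
    (Fin.cons (q (k + 2)) ![q (k + 1), q k] : Fin 3 → V)
      = (q ∘ Equiv.addRight (k + 2)) ∘ Equiv.swap 1 2 := by
  rw [← cons_eq_comp_addRight]
  funext i
  fin_cases i <;> rfl

theorem cons_fin_two (x : V) (w : Fin 2 → V) : (Fin.cons x w : Fin 3 → V) = ![x, w 0, w 1] := by
  funext i
  fin_cases i <;> rfl

/-- The values of an alternating function on the two triangles at an edge. -/
theorem alternating_apply {c : (Fin 3 → V) → ℤ}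
    (hc : ∀ (σ : Equiv.Perm (Fin 3)) v, c (v ∘ σ) = (Equiv.Perm.sign σ : ℤ) * c v)
    (q : Fin 3 → V) (k : Fin 3) :
    c (Fin.cons (q (k + 2)) ![q k, q (k + 1)]) = c q ∧
      c (Fin.cons (q (k + 2)) ![q (k + 1), q k]) = - c q := by
  have h1 : c (q ∘ Equiv.addRight (k + 2)) = c q := by rw [hc, sign_addRight_fin3]; simp
  constructor
  · rw [cons_eq_comp_addRight, h1]
  · rw [cons_swap_eq_comp, hc, h1, Equiv.Perm.sign_swap (by decide)]
    simp

theorem chain_three_eq_zero {K : AbstractSimplicialComplex V}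
    (hK : ∀ s ∈ K.faces, s.card ≤ 3) (b : Chain K 3) : b = 0 := by
  ext t
  by_contra hne
  obtain ⟨hi, hf⟩ := b.2.2 t hne
  have := hK _ hf
  rw [Finset.card_image_of_injective _ hi] at this
  simp at this

namespace IsOrientedTriangulation

variable {K : AbstractSimplicialComplex V} {p : F → Fin 3 → V}

section

variable (h : IsOrientedTriangulation K p)
include h

theorem fundamentalFun_corner (f : F) : fundamentalFun p (p f) = 1 := by
  unfold fundamentalFun
  rw [Finset.sum_eq_single f, Finset.sum_eq_single 1]
  · simp
  · intro π _ hπ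
    refine if_neg fun e => hπ ?_
    ext1 i
    exact h.corner_injective f (congrFun e i).symm
  · simp
  · intro f' _ hf'
    refine Finset.sum_eq_zero fun π _ => if_neg fun e => hf' (h.eq_of_comp e).symm
  · simp

/-- The signs are the coefficients of the fundamental chain. The two triangles at an edge traverse
it in opposite directions, so their signs relative to a fixed direction are opposite. -/
theorem coherentlyOrientable : CoherentlyOrientable K := by
  refine ⟨fundamentalFun p, fundamentalFun_comp p, ?_, ?_⟩
  · intro t ht hf
    obtain ⟨-, f, hf⟩ := (h.mem_faces _).1 hf
    obtain ⟨π, rfl⟩ := h.exists_perm ht hf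
    rw [fundamentalFun_comp, h.fundamentalFun_corner, mul_one]
    rcases Int.units_eq_one_or (Equiv.Perm.sign π) with e | e <;> simp [e]
  · intro x y u v hxy huv hxu hxv hyu hyv hx hy
    obtain ⟨f, k, rfl, rfl⟩ := h.exists_dart hx (u := u) (w := v) (by simp) (by simp) huv
    obtain ⟨f', k', h1, h2, -⟩ := h.exists_rev f k
    have e1 := (alternating_apply (fundamentalFun_comp p) (p f) k).1
    have e2 := (alternating_apply (fundamentalFun_comp p) (p f') k').2
    rw [h1, h2] at e2
    rw [cons_fin_two, h.fundamentalFun_corner] at e1 e2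
    simp only [Matrix.cons_val_zero, Matrix.cons_val_one] at e1 e2
    rcases h.eq_third_of_mem_faces h1 h2 hxu hxv hx (by simp) (by simp) (by simp) with rfl | rfl
    · rcases h.eq_third_of_mem_faces h1 h2 hyu hyv hy (by simp) (by simp) (by simp) with rfl | rfl
      · exact absurd rfl hxy
      · rw [e1, e2]; rfl
    · rcases h.eq_third_of_mem_faces h1 h2 hyu hyv hy (by simp) (by simp) (by simp) with rfl | rfl
      · rw [e1, e2]
      · exact absurd rfl hxy

/-- Triangulations of the combinatorial kind considered here are closed surfaces. -/
theorem isTriangulatedOrientableSurface {g : ℕ}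
    (hg : 2 * (Fintype.card V : ℤ) - Fintype.card F = 4 - 4 * g) :
    IsTriangulatedOrientableSurface K g where
  pure s hs := by
    obtain ⟨-, f, hf⟩ := (h.mem_faces s).1 hs
    exact ⟨_, h.image_mem_faces f, hf, h.card_image f⟩
  connected := by
    obtain ⟨c, hc⟩ := h.hub
    refine connectedSpace_carrier (c := c) fun v hv => ?_
    obtain ⟨f, k, rfl, rfl⟩ := hc v hv
    refine (h.mem_faces _).2 ⟨⟨p f k, by simp⟩, f, ?_⟩
    intro x hx
    simp only [Finset.mem_insert, Finset.mem_singleton] at hx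
    rcases hx with rfl | rfl <;> simp
  manifold := nonempty_chartedSpace_carrier h.exists_cycleLink
  orientable := h.coherentlyOrientable
  euler := by
    have h1 := h.two_mul_faceCount_one
    rw [h.faceCount_zero, h.faceCount_two]
    lia

/-- The boundary at an edge is the difference of the coefficients of its two triangles. -/
theorem boundary_apply (c : Chain K 2) {f f' : F} {k k' : Fin 3} (h1 : p f' k' = p f (k + 1))
    (h2 : p f' (k' + 1) = p f k) :
    (boundary K 1 c).1 ![p f k, p f (k + 1)] = c.1 (p f) - c.1 (p f') := by
  show ∑ x, c.1 (Fin.cons x ![p f k, p f (k + 1)]) = _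
  have e1 := (alternating_apply c.2.1 (p f) k).1
  have e2 := (alternating_apply c.2.1 (p f') k').2
  rw [h1, h2] at e2
  rw [← Finset.sum_subset (Finset.subset_univ {p f (k + 2), p f' (k' + 2)}),
    Finset.sum_pair (h.third_ne h1 h2).symm, e1, e2, sub_eq_add_neg]
  intro x _ hx
  by_contra hne
  obtain ⟨hi, hf⟩ := c.2.2 _ hne
  rw [cons_fin_two] at hi hf
  simp only [Finset.mem_insert, Finset.mem_singleton, not_or] at hx
  have hmem : ∀ i, (![x, p f k, p f (k + 1)] : Fin 3 → V) i
      ∈ Finset.univ.image ![x, p f k, p f (k + 1)] := fun i =>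
    Finset.mem_image_of_mem _ (Finset.mem_univ i)
  rcases h.eq_third_of_mem_faces h1 h2 (hi.ne (by decide : (0 : Fin 3) ≠ 1))
    (hi.ne (by decide : (0 : Fin 3) ≠ 2)) hf (hmem 0) (hmem 1) (hmem 2) with e | e
  · exact hx.1 e
  · exact hx.2 e

/-- The sum of all oriented triangles as a chain. -/
def fundamentalChain : Chain K 2 :=
  ⟨fundamentalFun p, fundamentalFun_comp p, fun t ht => by
    obtain ⟨f, π, rfl⟩ := exists_of_fundamentalFun_ne_zero ht
    exact ⟨(h.corner_injective f).comp π.injective, by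
      rw [image_comp_perm]; exact h.image_mem_faces f⟩⟩

theorem boundary_fundamentalChain : boundary K 1 h.fundamentalChain = 0 := by
  ext w
  by_contra hne
  obtain ⟨hi, hf⟩ := (boundary K 1 h.fundamentalChain).2.2 w hne
  obtain ⟨f, k, h0, h1⟩ := h.exists_dart hf (u := w 0) (w := w 1) (by simp) (by simp)
    (hi.ne (by decide))
  obtain ⟨f', k', h2, h3, -⟩ := h.exists_rev f k
  have hw : w = ![p f k, p f (k + 1)] := by
    funext i
    fin_cases i
    · exact h0.symm
    · exact h1.symm
  apply hne
  rw [hw, h.boundary_apply _ h2 h3]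
  show fundamentalFun p _ - fundamentalFun p _ = 0
  rw [h.fundamentalFun_corner, h.fundamentalFun_corner, sub_self]

/-- The vanishing boundary equates coefficients across each edge, hence around each vertex since the
rotation there is one orbit, hence everywhere since every vertex other than the hub lies in a
triangle with it. -/
theorem cycle_corner_eq {c : Chain K 2} (hc : boundary K 1 c = 0) (f f' : F) :
    c.1 (p f) = c.1 (p f') := by
  have hedge : ∀ {g g' : F} {k k' : Fin 3}, p g' k' = p g (k + 1) → p g' (k' + 1) = p g k →
      c.1 (p g) = c.1 (p g') := by
    intro g g' k k' h1 h2
    have := h.boundary_apply c h1 h2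
    rw [hc] at this
    exact (sub_eq_zero.1 this.symm)
  have hstep : ∀ {d d' : F × Fin 3}, LinkStep p d d' → c.1 (p d.1) = c.1 (p d'.1) := by
    intro d d' hd
    exact hedge (k := d.2 + 2) (k' := d'.2) (by rw [fin3_add_two_one]; exact hd.1) hd.2
  have hvert : ∀ {g g' : F} {k k' : Fin 3}, p g k = p g' k' → c.1 (p g) = c.1 (p g') := by
    intro g g' k k' e
    obtain ⟨d, hd, hall⟩ := h.link (p g k)
    have hto : ∀ d', ReflTransGen (LinkStep p) d d' → c.1 (p d.1) = c.1 (p d'.1) := by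
      intro d' hr
      induction hr with
      | refl => rfl
      | tail _ hs ih => exact ih.trans (hstep hs)
    rw [← hto (g, k) (hall (g, k) rfl), ← hto (g', k') (hall (g', k') e.symm)]
  obtain ⟨v, hv⟩ := h.hub
  have hhub : ∀ g : F, ∃ g' k', p g' k' = v ∧ c.1 (p g) = c.1 (p g') := by
    intro g
    by_cases e : p g 0 = v
    · exact ⟨g, 0, e, rfl⟩
    · obtain ⟨g', k', e1, e2⟩ := hv _ e
      exact ⟨g', k', e1, hvert e2.symm⟩
  obtain ⟨g, k, e1, e2⟩ := hhub f
  obtain ⟨g', k', e1', e2'⟩ := hhub f'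
  rw [e2, e2', hvert (e1.trans e1'.symm)]

/-- Every cycle is a multiple of the fundamental chain. -/
theorem cycle_eq_smul {c : Chain K 2} (hc : boundary K 1 c = 0) (f : F) :
    c = c.1 (p f) • h.fundamentalChain := by
  ext t
  show c.1 t = c.1 (p f) • fundamentalFun p t
  by_cases ht : ∃ f', ∃ π : Equiv.Perm (Fin 3), t = p f' ∘ π
  · obtain ⟨f', π, rfl⟩ := ht
    rw [c.2.1, fundamentalFun_comp, h.fundamentalFun_corner, h.cycle_corner_eq hc f f',
      smul_eq_mul, mul_one, mul_comm]
  · have h1 : fundamentalFun p t = 0 := by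
      by_contra hne
      exact ht (exists_of_fundamentalFun_ne_zero hne)
    rw [h1, smul_zero]
    by_contra hne
    obtain ⟨hi, hf⟩ := c.2.2 t hne
    obtain ⟨-, f', hf'⟩ := (h.mem_faces _).1 hf
    exact ht ⟨f', h.exists_perm hi hf'⟩

/-- The fundamental class of the oriented triangulation. -/
def fundamentalClass : H₂ K :=
  Submodule.Quotient.mk ⟨h.fundamentalChain, h.boundary_fundamentalChain⟩

theorem card_le_three : ∀ s ∈ K.faces, s.card ≤ 3 := by
  intro s hs
  obtain ⟨-, f, hf⟩ := (h.mem_faces s).1 hs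
  exact (Finset.card_le_card hf).trans (h.card_image f).le

/-- There are no 3-simplices, so no boundaries to divide by: `H₂` is the group of cycles. -/
theorem mk_eq_mk_iff {c c' : Cycles₂ K} :
    (Submodule.Quotient.mk c : H₂ K) = Submodule.Quotient.mk c' ↔ c = c' := by
  rw [Submodule.Quotient.eq]
  show ((c - c' : Cycles₂ K) : Chain K 2) ∈ LinearMap.range (boundary K 2) ↔ _
  rw [LinearMap.mem_range]
  constructor
  · rintro ⟨b, hb⟩
    rw [chain_three_eq_zero h.card_le_three b, map_zero] at hb
    exact sub_eq_zero.1 (Subtype.ext hb.symm)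
  · rintro rfl
    exact ⟨0, by simp⟩

theorem isInfiniteCyclicGenerator [Nonempty F] :
    IsInfiniteCyclicGenerator h.fundamentalClass := by
  obtain ⟨f⟩ := ‹Nonempty F›
  have hsmul : ∀ n : ℤ, n • h.fundamentalClass
      = Submodule.Quotient.mk (n • ⟨h.fundamentalChain, h.boundary_fundamentalChain⟩) := fun n =>
    rfl
  constructor
  · intro a b hab
    simp only [hsmul] at hab
    rw [h.mk_eq_mk_iff] at hab
    have e : a * fundamentalFun p (p f) = b * fundamentalFun p (p f) :=
      congrArg (fun c : Cycles₂ K => c.1.1 (p f)) hab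
    simpa [h.fundamentalFun_corner] using e
  · intro x
    obtain ⟨⟨c, hc⟩, rfl⟩ := Submodule.Quotient.mk_surjective _ x
    refine ⟨c.1 (p f), ?_⟩
    simp only [hsmul]
    rw [h.mk_eq_mk_iff]
    exact Subtype.ext (h.cycle_eq_smul hc f).symm

end

variable {W G : Type} [Fintype W] [DecidableEq W] [Fintype G] [DecidableEq G]
  {L : AbstractSimplicialComplex W} {q : G → Fin 3 → W}

/-- The degree of a simplicial map, counted over one triangle of the target. -/
theorem mapH₂_fundamentalClass (h : IsOrientedTriangulation K p) (hL : IsOrientedTriangulation L q)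
    (φ : SimplicialMap K L) (g : G) :
    φ.mapH₂ h.fundamentalClass = (∑ f, ∑ π : Equiv.Perm (Fin 3),
      if φ.toFun ∘ p f ∘ π = q g then (Equiv.Perm.sign π : ℤ) else 0) • hL.fundamentalClass := by
  have hcyc : boundary L 1 (φ.chainMap 2 h.fundamentalChain) = 0 := by
    rw [φ.boundary_chainMap, h.boundary_fundamentalChain, map_zero]
  have hval : (φ.chainMap 2 h.fundamentalChain).1 (q g) = ∑ f, ∑ π : Equiv.Perm (Fin 3),
      if φ.toFun ∘ p f ∘ π = q g then (Equiv.Perm.sign π : ℤ) else 0 := by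
    show ∑ t with φ.toFun ∘ t = q g, fundamentalFun p t = _
    unfold fundamentalFun
    rw [Finset.sum_comm]
    refine Finset.sum_congr rfl fun f _ => ?_
    rw [Finset.sum_comm]
    refine Finset.sum_congr rfl fun π _ => ?_
    rw [Finset.sum_ite_eq']
    simp
  have e := hL.cycle_eq_smul hcyc g
  rw [hval] at e
  show (Submodule.Quotient.mk ⟨φ.chainMap 2 h.fundamentalChain, hcyc⟩ : H₂ L) = _
  rw [fundamentalClass, ← Submodule.Quotient.mk_smul, hL.mk_eq_mk_iff]
  exact Subtype.ext e

end IsOrientedTriangulation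

end

end SurfaceMaps

/-! ### Complexes generated by triangles, and the 7-vertex torus. -/

namespace SurfaceMaps
open Relation

section

variable {V W F : Type} [Fintype V] [DecidableEq V] [Fintype W] [DecidableEq W] [Fintype F]
  [DecidableEq F]

/-- The complex generated by a family of triangles covering all vertices. -/
def triangleComplex (p : F → Fin 3 → V) (hp : ∀ v, ∃ f k, p f k = v) :
    AbstractSimplicialComplex V where
  faces := {s | s.Nonempty ∧ ∃ f, s ⊆ Finset.univ.image (p f)}
  isRelLowerSet_faces := fun _ hs =>
    ⟨hs.1, fun _ hts ht => ⟨ht, hs.2.imp fun _ h => hts.trans h⟩⟩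
  singleton_mem := fun v => ⟨Finset.singleton_nonempty v, by
    obtain ⟨f, k, rfl⟩ := hp v
    exact ⟨f, by simp⟩⟩

theorem mem_triangleComplex {p : F → Fin 3 → V} {hp : ∀ v, ∃ f k, p f k = v} (s : Finset V) :
    s ∈ (triangleComplex p hp).faces ↔ s.Nonempty ∧ ∃ f, s ⊆ Finset.univ.image (p f) :=
  Iff.rfl

theorem exists_corner_comp {p : F → Fin 3 → V} (hp : ∀ v, ∃ f k, p f k = v) (e : V ≃ W) (w : W) :
    ∃ f k, (e ∘ p f) k = w := by
  obtain ⟨f, k, h⟩ := hp (e.symm w)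
  exact ⟨f, k, by simp [h]⟩

theorem IsOrientedTriangulation.relabel {p : F → Fin 3 → V} {hp : ∀ v, ∃ f k, p f k = v}
    (h : IsOrientedTriangulation (triangleComplex p hp) p) (e : V ≃ W) :
    IsOrientedTriangulation (triangleComplex (fun f => e ∘ p f) (exists_corner_comp hp e))
      (fun f => e ∘ p f) where
  mem_faces := mem_triangleComplex
  ne f k := e.injective.ne (h.ne f k)
  edge_inj f f' k k' h1 h2 := h.edge_inj f f' k k' (e.injective h1) (e.injective h2)
  exists_rev f k := by
    obtain ⟨f', k', h1, h2, h3⟩ := h.exists_rev f k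
    exact ⟨f', k', congrArg e h1, congrArg e h2, e.injective.ne h3⟩
  link w := by
    obtain ⟨d, hd, hall⟩ := h.link (e.symm w)
    refine ⟨d, by simp [hd], fun d' hd' => ?_⟩
    exact ReflTransGen.mono (fun a b hab => ⟨congrArg e hab.1, congrArg e hab.2⟩) _ _
      (hall d' (by rw [← hd']; simp))
  hub := by
    obtain ⟨c, hc⟩ := h.hub
    refine ⟨e c, fun w hw => ?_⟩
    obtain ⟨f, k, h1, h2⟩ := hc (e.symm w) (fun e' => hw (by rw [← e']; simp))
    exact ⟨f, k, congrArg e h1, by simp [h2]⟩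

/-- Opposite directed edges exist as soon as every corner has a successor in the rotation around
its vertex. -/
theorem exists_rev_of_exists_linkStep {p : F → Fin 3 → V}
    (h : ∀ d : F × Fin 3, ∃ d', LinkStep p d d' ∧ p d'.1 (d'.2 + 2) ≠ p d.1 (d.2 + 1))
    (f : F) (k : Fin 3) : ∃ f' k', p f' k' = p f (k + 1) ∧ p f' (k' + 1) = p f k ∧
      p f' (k' + 2) ≠ p f (k + 2) := by
  obtain ⟨d', ⟨h1, h2⟩, h3⟩ := h (f, k + 1)
  refine ⟨d'.1, d'.2, h1, ?_, ?_⟩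
  · rw [h2, fin3_add_one_two]
  · simpa only [fin3_add_one_one] using h3

end

/-- The triangles of `torus₇`, coherently oriented. -/
def torusCorner : Fin 14 → Fin 3 → Fin 7 :=
  ![![1, 5, 0], ![4, 0, 5], ![2, 1, 4], ![3, 4, 1], ![0, 2, 3], ![5, 3, 2], ![1, 0, 3], ![2, 4, 5],
    ![6, 0, 4], ![6, 1, 2], ![6, 2, 0], ![6, 3, 5], ![6, 4, 3], ![6, 5, 1]]

/-- A corner of `torus₇` at each vertex. -/
def torusBaseCorner : Fin 7 → Fin 14 × Fin 3 :=
  ![(0, 2), (0, 0), (2, 0), (3, 0), (1, 0), (0, 1), (8, 0)]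

instance {V F : Type} [DecidableEq V] (p : F → Fin 3 → V) (d d' : F × Fin 3) :
    Decidable (LinkStep p d d') :=
  inferInstanceAs (Decidable (_ ∧ _))

theorem torusTriangles_eq :
    torusTriangles = Finset.univ.image fun f => Finset.univ.image (torusCorner f) := by
  decide

/-- The triangle of `torus₇` following a given corner in the rotation around its vertex. -/
def torusNext (d : Fin 14 × Fin 3) : Fin 14 × Fin 3 :=
  -- The default `d` is never taken: `linkStep_torusNext` checks that the value is a successor of
  -- `d`, and no corner succeeds itself.
  ((List.finRange 14 ×ˢ List.finRange 3).find? fun d' => LinkStep torusCorner d d').getD d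

set_option maxRecDepth 10000 in
theorem linkStep_torusNext : ∀ d, LinkStep torusCorner d (torusNext d) ∧
    torusCorner (torusNext d).1 ((torusNext d).2 + 2) ≠ torusCorner d.1 (d.2 + 1) := by
  decide +kernel

theorem reflTransGen_iterate {A : Type} {r : A → A → Prop} {f : A → A} (h : ∀ a, r a (f a))
    (n : ℕ) (a : A) : ReflTransGen r a (f^[n] a) := by
  induction n with
  | zero => exact .refl
  | succ n ih => rw [Function.iterate_succ_apply']; exact ih.tail (h _)

/-- Each vertex has degree six (the 7-vertex torus has a complete 1-skeleton), so fewer than six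
rotation steps suffice. -/
theorem torus_link : ∀ v, torusCorner (torusBaseCorner v).1 (torusBaseCorner v).2 = v ∧
    ∀ d' : Fin 14 × Fin 3, torusCorner d'.1 d'.2 = v →
      ∃ j : Fin 6, torusNext^[j] (torusBaseCorner v) = d' := by
  decide +kernel

theorem isOrientedTriangulation_torus₇ : IsOrientedTriangulation torus₇ torusCorner where
  mem_faces s := by
    show (s.Nonempty ∧ ∃ t ∈ torusTriangles, s ⊆ t) ↔ _
    simp [torusTriangles_eq]
  ne := by decide +kernel
  edge_inj := by decide +kernel
  exists_rev := exists_rev_of_exists_linkStep fun d => ⟨_, linkStep_torusNext d⟩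
  link v := by
    refine ⟨_, (torus_link v).1, fun d' hd' => ?_⟩
    obtain ⟨j, rfl⟩ := (torus_link v).2 d' hd'
    exact reflTransGen_iterate (fun d => (linkStep_torusNext d).1) _ _
  hub := ⟨6, by decide +kernel⟩

end SurfaceMaps

/-! ### The ramified covering and single steps of its rotation. -/

namespace SurfaceMaps
open Relation Equiv

/-- The oriented triangles of `torus₇` away from its last vertex. -/
def baseVert : Fin 8 → Fin 3 → Fin 6 :=
  ![![1, 5, 0], ![4, 0, 5], ![2, 1, 4], ![3, 4, 1], ![0, 2, 3], ![5, 3, 2], ![1, 0, 3], ![2, 4, 5]]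

/-- The successor of a vertex of `torus₇` in the link of the last vertex. -/
def hexNext : Fin 6 → Fin 6 := ![4, 2, 0, 5, 3, 1]

/-- The predecessor of a vertex of `torus₇` in the link of the last vertex. -/
def hexPrev : Fin 6 → Fin 6 := ![2, 5, 1, 4, 0, 3]

/-- The corners of the triangles `baseVert` at a given vertex, in cyclic order. -/
def vertCorner : Fin 6 → Fin 4 → Fin 8 × Fin 3 :=
  ![![(4, 0), (6, 1), (0, 2), (1, 1)], ![(0, 0), (6, 0), (3, 2), (2, 1)],
    ![(2, 0), (7, 0), (5, 2), (4, 1)], ![(3, 0), (6, 2), (4, 2), (5, 1)],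
    ![(1, 0), (7, 1), (2, 2), (3, 1)], ![(5, 0), (7, 2), (1, 2), (0, 1)]]

section

variable {S : Type}

/-- The sheets of the corners of the triangles lying over `baseVert`. -/
def baseVolt (α β : Perm S) : Fin 8 → Fin 3 → Perm S :=
  ![![1, α⁻¹, 1], ![1, α, 1], ![1, β, 1], ![1, β⁻¹, 1], ![1, 1, 1], ![1, 1, 1], ![1, 1, 1],
    ![1, 1, 1]]

/-- The change of sheet along the edges of the link of the last vertex. -/
def hexVolt (α β τ : Perm S) : Fin 6 → Perm S := ![α⁻¹, β⁻¹, τ, 1, β, α]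

/-- The triangles of the ramified covering: those lying over the triangles `baseVert`, those at the
ramification vertex, and those which fill the slit. -/
abbrev CoverFace (τ : Perm S) (o : S) : Type :=
  (Fin 8 × S) ⊕ (Fin 6 × S) ⊕ (Bool × {s // τ s ≠ s ∧ s ≠ o})

/-- The corners of the triangles of the ramified covering. The vertex `none` is the ramification
point, `some (x, s)` lies over `x` in the sheet `s`. -/
def coverCorner (α β τ : Perm S) (o : S) : CoverFace τ o → Fin 3 → Option (Fin 6 × S)
  | .inl (j, s) => fun k => some (baseVert j k, baseVolt α β j k s)
  | .inr (.inl (x, s)) => ![none, some (x, s), some (hexNext x, hexVolt α β τ x s)]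
  -- The hole is bounded by the polygon `(2, s), (0, τ s), (2, τ s), (0, τ² s), …`: its edges are
  -- alternately those left open by the triangles at the ramification vertex and by the triangles
  -- over `{0, 2, 3}`. The fan has apex `(2, o)`, which is why `s = o` is left out.
  | .inr (.inr (false, s)) => ![some (2, o), some (0, τ s), some (2, s)]
  | .inr (.inr (true, s)) => ![some (2, o), some (2, s), some (0, s)]

variable {α β τ : Perm S} {o : S}

local notation "B(" j "," s ")" => (Sum.inl (j, s) : CoverFace τ o)
local notation "H(" x "," s ")" => (Sum.inr (Sum.inl (x, s)) : CoverFace τ o)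
local notation "D(" b "," s ")" => (Sum.inr (Sum.inr (b, s)) : CoverFace τ o)

theorem baseVert_ne : ∀ j k, baseVert j k ≠ baseVert j (k + 1) := by decide
theorem hexNext_ne : ∀ x, x ≠ hexNext x := by decide
theorem hexNext_hexPrev : ∀ x, hexNext (hexPrev x) = x := by decide
theorem hexNext_injective : Function.Injective hexNext := by decide
theorem baseVert_edge_inj : ∀ j j' k k', baseVert j k = baseVert j' k' →
    baseVert j (k + 1) = baseVert j' (k' + 1) → j = j' ∧ k = k' := by decide
theorem baseVert_ne_hexNext : ∀ j k, baseVert j (k + 1) ≠ hexNext (baseVert j k) := by decide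
theorem baseVert_edge_zero_two : ∀ j k, baseVert j k = 0 → baseVert j (k + 1) = 2 →
    j = 4 ∧ k = 0 := by decide

theorem coverCorner_ne (f : CoverFace τ o) (k : Fin 3) :
    coverCorner α β τ o f k ≠ coverCorner α β τ o f (k + 1) := by
  rcases f with ⟨j, s⟩ | ⟨x, s⟩ | ⟨_ | _, s, hs, hso⟩
  · intro e
    simp only [coverCorner, Option.some.injEq, Prod.mk.injEq] at e
    exact baseVert_ne j k e.1
  · have := hexNext_ne x
    fin_cases k <;> simp [coverCorner, this]
  · fin_cases k <;> simp [coverCorner, hso]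
  · fin_cases k <;> simp [coverCorner, hso, Ne.symm hso]

/-- Triangles of different kinds share no directed edge. Below, those over `baseVert` never run from
`x` to `hexNext x`. Over `{0, 2}` they run only `(0, s) → (2, s)`, while the triangles at the
ramification vertex run only `(2, s) → (0, τ s)`. The fan contains neither kind, as `s ≠ o` and `τ s
≠ s`. -/
theorem coverCorner_edge_inj (f f' : CoverFace τ o) (k k' : Fin 3)
    (h1 : coverCorner α β τ o f k = coverCorner α β τ o f' k')
    (h2 : coverCorner α β τ o f (k + 1) = coverCorner α β τ o f' (k' + 1)) :
    f = f' ∧ k = k' := by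
  have base_hex : ∀ (j : Fin 8) (s : S) (x : Fin 6) (t : S) (k k' : Fin 3),
      coverCorner α β τ o B(j, s) k = coverCorner α β τ o H(x, t) k' →
      coverCorner α β τ o B(j, s) (k + 1) ≠ coverCorner α β τ o H(x, t) (k' + 1) := by
    intro j s x t k k' h1 h2
    have h := baseVert_ne_hexNext j k
    fin_cases k' <;> simp [coverCorner] at h1 h2
    exact h (by rw [h1.1, h2.1])
  have base_slit : ∀ (j : Fin 8) (s : S) (b : Bool) (t : {s // τ s ≠ s ∧ s ≠ o}) (k k' : Fin 3),
      coverCorner α β τ o B(j, s) k = coverCorner α β τ o D(b, t) k' →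
      coverCorner α β τ o B(j, s) (k + 1) ≠ coverCorner α β τ o D(b, t) (k' + 1) := by
    rintro j s b ⟨t, ht, hto⟩ k k' h1 h2
    have n1 := baseVert_ne j k
    have n2 := baseVert_ne_hexNext j k
    have n3 := baseVert_edge_zero_two j k
    cases b <;> fin_cases k' <;> simp [coverCorner] at h1 h2
    · exact n2 (by rw [h1.1, h2.1]; rfl)
    · obtain ⟨rfl, rfl⟩ := n3 h1.1 h2.1
      simp [baseVolt] at h1 h2
      exact ht (h1.2.symm.trans h2.2)
    · exact n1 (h1.1.trans h2.1.symm)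
    · exact n1 (h1.1.trans h2.1.symm)
    · exact n2 (by rw [h1.1, h2.1]; rfl)
    · obtain ⟨rfl, rfl⟩ := n3 h1.1 h2.1
      simp [baseVolt] at h1 h2
      exact hto (h1.2.symm.trans h2.2)
  have hex_slit : ∀ (x : Fin 6) (s : S) (b : Bool) (t : {s // τ s ≠ s ∧ s ≠ o}) (k k' : Fin 3),
      coverCorner α β τ o H(x, s) k = coverCorner α β τ o D(b, t) k' →
      coverCorner α β τ o H(x, s) (k + 1) ≠ coverCorner α β τ o D(b, t) (k' + 1) := by
    rintro x s b ⟨t, ht, hto⟩ k k' h1 h2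
    cases b <;> fin_cases k <;> fin_cases k' <;> simp [coverCorner] at h1 h2 <;>
      obtain ⟨rfl, rfl⟩ := h1 <;> simp_all [hexNext, hexVolt]
  rcases f with ⟨j, s⟩ | ⟨x, s⟩ | ⟨b, s⟩ <;> rcases f' with ⟨j', s'⟩ | ⟨x', s'⟩ | ⟨b', s'⟩
  · simp only [coverCorner, Option.some.injEq, Prod.mk.injEq] at h1 h2
    obtain ⟨rfl, rfl⟩ := baseVert_edge_inj _ _ _ _ h1.1 h2.1
    obtain rfl := (baseVolt α β j k).injective h1.2
    exact ⟨rfl, rfl⟩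
  · exact absurd h2 (base_hex _ _ _ _ _ _ h1)
  · exact absurd h2 (base_slit _ _ _ _ _ _ h1)
  · exact absurd h2.symm (base_hex _ _ _ _ _ _ h1.symm)
  · fin_cases k <;> fin_cases k' <;> simp [coverCorner] at h1 h2 ⊢
    · exact h2
    · exact h1
    · obtain rfl := hexNext_injective h1.1
      exact ⟨rfl, (hexVolt α β τ x).injective h1.2⟩
  · exact absurd h2 (hex_slit _ _ _ _ _ _ h1)
  · exact absurd h2.symm (base_slit _ _ _ _ _ _ h1.symm)
  · exact absurd h2.symm (hex_slit _ _ _ _ _ _ h1.symm)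
  · obtain ⟨s, hs, hso⟩ := s
    obtain ⟨s', hs', hso'⟩ := s'
    cases b <;> cases b' <;> fin_cases k <;> fin_cases k' <;> simp [coverCorner] at h1 h2 ⊢ <;>
      grind

/-- A step in the rotation around a vertex which does not return to the previous neighbour. -/
def ProperStep {V F : Type} (p : F → Fin 3 → V) (d d' : F × Fin 3) : Prop :=
  LinkStep p d d' ∧ p d'.1 (d'.2 + 2) ≠ p d.1 (d.2 + 1)

local notation "Step" => ProperStep (coverCorner α β τ o)

/-- The corner number `a` at the vertex `some (x, s)`. -/
def baseCorner (α β τ : Perm S) (o : S) (x : Fin 6) (a : Fin 4) (s : S) :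
    CoverFace τ o × Fin 3 :=
  (.inl ((vertCorner x a).1, (baseVolt α β (vertCorner x a).1 (vertCorner x a).2)⁻¹ s),
    (vertCorner x a).2)

local notation "C(" x "," a "," s ")" => baseCorner α β τ o x a s

theorem step_center (x : Fin 6) (s : S) :
    Step (H(x, s), 0) (H(hexNext x, hexVolt α β τ x s), 0) := by
  refine ⟨⟨rfl, rfl⟩, ?_⟩
  have : hexNext (hexNext x) ≠ x := by revert x; decide
  simp [coverCorner, this]

/-- Around `some (x, s)` the rotation passes the two triangles at `none`, then the four corners
`baseCorner`, and returns. Only for `x = 2` (on leaving the last of the four) and `x = 0` (on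
entering the first) can it make a detour through the fan. -/
theorem step_hex (x : Fin 6) (s : S) :
    Step (H(x, s), 1) (H(hexPrev x, (hexVolt α β τ (hexPrev x))⁻¹ s), 2) := by
  have : hexPrev x ≠ hexNext x := by revert x; decide
  refine ⟨⟨?_, rfl⟩, ?_⟩
  · simp [coverCorner, hexNext_hexPrev]
  · simp [coverCorner, this]

theorem step_first {x : Fin 6} (hx : x ≠ 0) (s : S) :
    Step (H(hexPrev x, (hexVolt α β τ (hexPrev x))⁻¹ s), 2) C(x, 0, s) := by
  fin_cases x <;> first
    | exact absurd rfl hx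
    | simp [ProperStep, LinkStep, coverCorner, baseCorner, vertCorner, baseVert, baseVolt, hexPrev,
        hexNext, hexVolt]

theorem step_base (x : Fin 6) {a : Fin 4} (ha : a ≠ 3) (s : S) :
    Step C(x, a, s) C(x, a + 1, s) := by
  fin_cases x <;> fin_cases a <;> first
    | exact absurd rfl ha
    | simp [ProperStep, LinkStep, coverCorner, baseCorner, vertCorner, baseVert, baseVolt]

theorem step_last {x : Fin 6} (hx : x ≠ 2) (s : S) : Step C(x, 3, s) (H(x, s), 1) := by
  fin_cases x <;> first
    | exact absurd rfl hx
    | simp [ProperStep, LinkStep, coverCorner, baseCorner, vertCorner, baseVert, baseVolt,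
        hexNext, hexVolt]

theorem step_last_fixed {s : S} (hs : τ s = s) : Step C(2, 3, s) (H(2, s), 1) := by
  simp [ProperStep, LinkStep, coverCorner, baseCorner, vertCorner, baseVert, baseVolt, hexNext,
    hexVolt, hs]

theorem step_slit_two_in {s : S} (hs : τ s ≠ s ∧ s ≠ o) :
    Step C(2, 3, s) (D(true, ⟨s, hs⟩), 1) := by
  simp [ProperStep, LinkStep, coverCorner, baseCorner, vertCorner, baseVert, baseVolt]

theorem step_slit_two_mid (s : {s // τ s ≠ s ∧ s ≠ o}) :
    Step (D(true, s), 1) (D(false, s), 2) := by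
  simp [ProperStep, LinkStep, coverCorner, s.2.1]

theorem step_slit_two_out (s : {s // τ s ≠ s ∧ s ≠ o}) :
    Step (D(false, s), 2) (H(2, s.1), 1) := by
  simp [ProperStep, LinkStep, coverCorner, hexNext, hexVolt]

/-- At the apex `(2, o)` the rotation sweeps the whole fan, through the sheets `τ⁻¹ o, τ⁻² o, …, τ
o`, before it returns to the triangles at `none`. -/
theorem step_apex_in (s : {s // τ s ≠ s ∧ s ≠ o}) (hs : τ s.1 = o) :
    Step C(2, 3, o) (D(false, s), 0) := by
  simp [ProperStep, LinkStep, coverCorner, baseCorner, vertCorner, baseVert, baseVolt, hs]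

theorem step_apex_mid (s : {s // τ s ≠ s ∧ s ≠ o}) :
    Step (D(false, s), 0) (D(true, s), 0) := by
  simp [ProperStep, LinkStep, coverCorner, Ne.symm s.2.1]

theorem step_apex_next (s s' : {s // τ s ≠ s ∧ s ≠ o}) (hs : τ s'.1 = s.1) :
    Step (D(true, s), 0) (D(false, s'), 0) := by
  have : s'.1 ≠ s.1 := fun e => s'.2.1 (by rw [hs, e])
  simp [ProperStep, LinkStep, coverCorner, hs, this]

theorem step_apex_out (s : {s // τ s ≠ s ∧ s ≠ o}) (hs : τ o = s.1) :
    Step (D(true, s), 0) (H(2, o), 1) := by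
  simp [ProperStep, LinkStep, coverCorner, hexNext, hexVolt, hs]

theorem step_zero_fixed {s : S} (hs : τ s = s) : Step (H(2, s), 2) C(0, 0, s) := by
  simp [ProperStep, LinkStep, coverCorner, baseCorner, vertCorner, baseVert, baseVolt, hexNext,
    hexVolt, hs]

/-- The detour at `(0, τ s)` meets one fan triangle indexed by `s` and one indexed by `τ s`; the
first is missing when `s = o`, the second when `τ s = o`. -/
theorem step_zero_in (s : {s // τ s ≠ s ∧ s ≠ o}) : Step (H(2, s.1), 2) (D(false, s), 1) := by
  simp [ProperStep, LinkStep, coverCorner, hexNext, hexVolt]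

theorem step_zero_in_apex (s : {s // τ s ≠ s ∧ s ≠ o}) (hs : τ o = s.1) :
    Step (H(2, o), 2) (D(true, s), 2) := by
  simp [ProperStep, LinkStep, coverCorner, hexNext, hexVolt, hs]

theorem step_zero_mid (s s' : {s // τ s ≠ s ∧ s ≠ o}) (hs : τ s.1 = s'.1) :
    Step (D(false, s), 1) (D(true, s'), 2) := by
  have : s'.1 ≠ s.1 := fun e => s.2.1 (by rw [hs, e])
  simp [ProperStep, LinkStep, coverCorner, hs, this]

theorem step_zero_out_apex (s : {s // τ s ≠ s ∧ s ≠ o}) (hs : τ s.1 = o) :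
    Step (D(false, s), 1) C(0, 0, o) := by
  simp [ProperStep, LinkStep, coverCorner, baseCorner, vertCorner, baseVert, baseVolt, hs]

theorem step_zero_out (s : {s // τ s ≠ s ∧ s ≠ o}) : Step (D(true, s), 2) C(0, 0, s.1) := by
  simp [ProperStep, LinkStep, coverCorner, baseCorner, vertCorner, baseVert, baseVolt]

end

end SurfaceMaps

/-! ### The rotation around every vertex of the covering is a single orbit. -/

namespace SurfaceMaps
open Relation Equiv

section

variable {S : Type} {α β τ : Perm S} {o : S}

local notation "B(" j "," s ")" => (Sum.inl (j, s) : CoverFace τ o)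
local notation "H(" x "," s ")" => (Sum.inr (Sum.inl (x, s)) : CoverFace τ o)
local notation "D(" b "," s ")" => (Sum.inr (Sum.inr (b, s)) : CoverFace τ o)
local notation "C(" x "," a "," s ")" => baseCorner α β τ o x a s
local notation "Step" => ProperStep (coverCorner α β τ o)
local notation "Reach" => ReflTransGen (LinkStep (coverCorner α β τ o))

theorem perm_inv_apply_self (π : Perm S) (s : S) : π⁻¹ (π s) = s := π.symm_apply_apply s

theorem perm_apply_inv_self (π : Perm S) (s : S) : π (π⁻¹ s) = s := π.apply_symm_apply s

theorem exists_vertCorner : ∀ j k, ∃ a, vertCorner (baseVert j k) a = (j, k) := by decide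

theorem exists_eq_baseCorner (j : Fin 8) (k : Fin 3) (s : S) :
    ∃ a, (B(j, s), k) = C(baseVert j k, a, baseVolt α β j k s) := by
  obtain ⟨a, ha⟩ := exists_vertCorner j k
  refine ⟨a, ?_⟩
  simp only [baseCorner, ha, perm_inv_apply_self]

theorem apply_ne_self_of_apply {s : S} (h : τ s ≠ s) : τ (τ s) ≠ τ s := τ.injective.ne h

theorem exists_properStep (ho : τ o ≠ o) (d : CoverFace τ o × Fin 3) : ∃ d', Step d d' := by
  obtain ⟨⟨j, s⟩ | ⟨x, s⟩ | ⟨b, s⟩, k⟩ := d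
  · obtain ⟨a, ha⟩ := exists_eq_baseCorner (τ := τ) (o := o) (α := α) (β := β) j k s
    rw [ha]
    generalize baseVolt α β j k s = t
    generalize baseVert j k = x
    by_cases ha3 : a = 3
    · subst ha3
      by_cases hx : x = 2
      · subst hx
        by_cases ht : τ t = t
        · exact ⟨_, step_last_fixed ht⟩
        by_cases hto : t = o
        · subst hto
          have hu : τ (τ.symm t) = t := τ.apply_symm_apply t
          refine ⟨_, step_apex_in ⟨τ.symm t, ?_, ?_⟩ hu⟩
          · rw [hu]; intro e; rw [← e] at hu; exact ht hu
          · intro e; rw [e] at hu; exact ht hu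
        · exact ⟨_, step_slit_two_in ⟨ht, hto⟩⟩
      · exact ⟨_, step_last hx t⟩
    · exact ⟨_, step_base x ha3 t⟩
  · rcases fin3_eq 0 k with rfl | rfl | rfl
    · exact ⟨_, step_center x s⟩
    · exact ⟨_, step_hex x s⟩
    · by_cases hx : x = 2
      · subst hx
        by_cases hs : τ s = s
        · exact ⟨_, step_zero_fixed hs⟩
        by_cases hso : s = o
        · subst hso
          exact ⟨_, step_zero_in_apex ⟨τ s, apply_ne_self_of_apply hs, hs⟩ rfl⟩
        · exact ⟨_, step_zero_in ⟨s, hs, hso⟩⟩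
      · have e : ∀ x : Fin 6, hexPrev (hexNext x) = x := by decide
        have h0 : ∀ x : Fin 6, x ≠ 2 → hexNext x ≠ 0 := by decide
        have := step_first (α := α) (β := β) (τ := τ) (o := o) (h0 x hx) (hexVolt α β τ x s)
        rw [e, perm_inv_apply_self] at this
        exact ⟨_, this⟩
  · cases b <;> rcases fin3_eq 0 k with rfl | rfl | rfl
    · exact ⟨_, step_apex_mid s⟩
    · by_cases h : τ s.1 = o
      · exact ⟨_, step_zero_out_apex s h⟩
      · exact ⟨_, step_zero_mid s ⟨τ s.1, apply_ne_self_of_apply s.2.1, h⟩ rfl⟩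
    · exact ⟨_, step_slit_two_out s⟩
    · by_cases h : τ o = s.1
      · exact ⟨_, step_apex_out s h⟩
      · have hu : τ (τ.symm s.1) = s.1 := τ.apply_symm_apply _
        refine ⟨_, step_apex_next s ⟨τ.symm s.1, ?_, ?_⟩ hu⟩
        · rw [hu]; intro e; rw [← e] at hu; exact s.2.1 hu
        · intro e; rw [e] at hu; exact h hu
    · exact ⟨_, step_slit_two_mid s⟩
    · exact ⟨_, step_zero_out s⟩

theorem reach_baseCorner_zero (ho : τ o ≠ o) (x : Fin 6) (s : S) :
    Reach (H(x, s), 1) C(x, 0, s) := by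
  refine (ReflTransGen.single (step_hex x s).1).trans ?_
  by_cases hx : x = 0
  · subst hx
    show Reach (H(2, τ⁻¹ s), 2) C(0, 0, s)
    obtain ⟨u, rfl⟩ := τ.surjective s
    rw [perm_inv_apply_self]
    by_cases hu : τ u = u
    · rw [hu]; exact .single (step_zero_fixed hu).1
    by_cases huo : u = o
    · subst huo
      exact (ReflTransGen.single (step_zero_in_apex ⟨τ u, apply_ne_self_of_apply hu, hu⟩ rfl).1).tail
        (step_zero_out _).1
    · have h1 : Reach (H(2, u), 2) (D(false, ⟨u, hu, huo⟩), 1) := .single (step_zero_in ⟨u, hu, huo⟩).1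
      by_cases hto : τ u = o
      · rw [hto]; exact h1.tail (step_zero_out_apex _ hto).1
      · exact (h1.tail
          (step_zero_mid _ ⟨τ u, apply_ne_self_of_apply hu, hto⟩ rfl).1).tail (step_zero_out _).1
  · exact .single (step_first hx s).1

theorem reach_baseCorner (ho : τ o ≠ o) (x : Fin 6) (a : Fin 4) (s : S) :
    Reach (H(x, s), 1) C(x, a, s) := by
  have h0 := reach_baseCorner_zero (α := α) (β := β) ho x s
  have h1 := h0.tail (step_base x (a := 0) (by decide) s).1
  have h2 := h1.tail (step_base x (a := 1) (by decide) s).1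
  have h3 := h2.tail (step_base x (a := 2) (by decide) s).1
  fin_cases a <;> assumption

/-- Here `τ` must be a single cycle: the sheets met at the apex are successive powers of `τ⁻¹`
applied to `o`, and they have to exhaust the support. -/
theorem reach_apex [Finite S] (hτ : τ.IsCycle) (ho : τ o ≠ o) (s : {s // τ s ≠ s ∧ s ≠ o}) :
    Reach (H(2, o), 1) (D(false, s), 0) := by
  have key : ∀ j : ℕ, ∀ s : {s // τ s ≠ s ∧ s ≠ o}, (τ⁻¹ ^ j) o = s.1 →
      Reach (H(2, o), 1) (D(false, s), 0) := by
    intro j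
    induction j with
    | zero => intro s hs; exact absurd hs.symm s.2.2
    | succ j ih =>
      intro s hs
      rw [pow_succ', Perm.mul_apply, Perm.inv_eq_iff_eq] at hs
      by_cases hso : τ s.1 = o
      · exact (reach_baseCorner ho 2 3 o).tail (step_apex_in s hso).1
      · have := ih ⟨τ s.1, apply_ne_self_of_apply s.2.1, hso⟩ hs
        exact (this.tail (step_apex_mid _).1).tail (step_apex_next _ s rfl).1
  obtain ⟨j, hj⟩ := hτ.inv.exists_pow_eq (x := o) (y := s.1)
    (by rw [Ne, Perm.inv_eq_iff_eq]; exact ho.symm) (by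
      rw [Ne, Perm.inv_eq_iff_eq]; exact s.2.1.symm)
  exact key j s hj

theorem reach_some [Finite S] (hτ : τ.IsCycle) (ho : τ o ≠ o) (x : Fin 6) (s : S)
    (d : CoverFace τ o × Fin 3) (hd : coverCorner α β τ o d.1 d.2 = some (x, s)) :
    Reach (H(x, s), 1) d := by
  obtain ⟨⟨j, t⟩ | ⟨y, t⟩ | ⟨b, t⟩, k⟩ := d
  · obtain ⟨a, ha⟩ := exists_eq_baseCorner (τ := τ) (o := o) (α := α) (β := β) j k t
    simp only [coverCorner, Option.some.injEq, Prod.mk.injEq] at hd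
    rw [ha, hd.1, hd.2]
    exact reach_baseCorner ho x a s
  · rcases fin3_eq 0 k with rfl | rfl | rfl
    · simp [coverCorner] at hd
    · simp only [coverCorner, zero_add, Matrix.cons_val_one, Matrix.cons_val_zero,
        Option.some.injEq, Prod.mk.injEq] at hd
      obtain ⟨rfl, rfl⟩ := hd
      exact .refl
    · have hd' : some (hexNext y, hexVolt α β τ y t) = some (x, s) := hd
      simp only [Option.some.injEq, Prod.mk.injEq] at hd'
      obtain ⟨rfl, rfl⟩ := hd'
      have e : ∀ x : Fin 6, hexPrev (hexNext x) = x := by decide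
      have := step_hex (α := α) (β := β) (τ := τ) (o := o) (hexNext y) (hexVolt α β τ y t)
      rw [e, perm_inv_apply_self] at this
      exact .single this.1
  · have hfan := reach_apex (α := α) (β := β) hτ ho t
    have hout : ∀ s : {s // τ s ≠ s ∧ s ≠ o}, Reach (H(2, s.1), 1) (D(true, s), 1) := fun s =>
      (reach_baseCorner ho 2 3 s.1).tail (step_slit_two_in s.2).1
    have hzero : ∀ s : {s // τ s ≠ s ∧ s ≠ o}, Reach (H(0, τ s.1), 1) (D(false, s), 1) := by
      intro s
      have := step_hex (α := α) (β := β) (τ := τ) (o := o) 0 (τ s.1)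
      have e : hexPrev 0 = 2 := rfl
      rw [e, show hexVolt α β τ 2 = τ from rfl, perm_inv_apply_self] at this
      exact (ReflTransGen.single this.1).tail (step_zero_in s).1
    cases b <;> rcases fin3_eq 0 k with rfl | rfl | rfl
    · have hd' : some ((2 : Fin 6), o) = some (x, s) := hd
      simp only [Option.some.injEq, Prod.mk.injEq] at hd'
      obtain ⟨rfl, rfl⟩ := hd'
      exact hfan
    · have hd' : some ((0 : Fin 6), τ t.1) = some (x, s) := hd
      simp only [Option.some.injEq, Prod.mk.injEq] at hd'
      obtain ⟨rfl, rfl⟩ := hd'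
      exact hzero t
    · have hd' : some ((2 : Fin 6), t.1) = some (x, s) := hd
      simp only [Option.some.injEq, Prod.mk.injEq] at hd'
      obtain ⟨rfl, rfl⟩ := hd'
      exact (hout t).tail (step_slit_two_mid t).1
    · have hd' : some ((2 : Fin 6), o) = some (x, s) := hd
      simp only [Option.some.injEq, Prod.mk.injEq] at hd'
      obtain ⟨rfl, rfl⟩ := hd'
      exact hfan.tail (step_apex_mid t).1
    · have hd' : some ((2 : Fin 6), t.1) = some (x, s) := hd
      simp only [Option.some.injEq, Prod.mk.injEq] at hd'
      obtain ⟨rfl, rfl⟩ := hd'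
      exact hout t
    · have hd' : some ((0 : Fin 6), t.1) = some (x, s) := hd
      simp only [Option.some.injEq, Prod.mk.injEq] at hd'
      obtain ⟨rfl, rfl⟩ := hd'
      have hu : τ (τ.symm t.1) = t.1 := τ.apply_symm_apply _
      by_cases hto : τ o = t.1
      · have := step_hex (α := α) (β := β) (τ := τ) (o := o) 0 t.1
        have e : hexPrev 0 = 2 := rfl
        rw [e, show hexVolt α β τ 2 = τ from rfl, ← hto, perm_inv_apply_self] at this
        rw [← hto]
        exact (ReflTransGen.single this.1).tail (step_zero_in_apex t hto).1
      · have h1 : τ (τ.symm t.1) ≠ τ.symm t.1 ∧ τ.symm t.1 ≠ o := by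
          constructor
          · rw [hu]; intro e; rw [← e] at hu; exact t.2.1 hu
          · intro e; rw [e] at hu; exact hto hu
        have := hzero ⟨τ.symm t.1, h1⟩
        simp only [hu] at this
        exact this.tail (step_zero_mid _ t hu).1

/-- One turn around the hexagon changes the sheet by the total monodromy. Its transitivity reaches
every sheet over `2`, and the bijective sheet changes carry this to the other five vertices. -/
theorem reach_none (hρ : ∀ s, ∃ j : ℕ, ((β⁻¹ * α * β * α⁻¹ * τ) ^ j) o = s)
    (d : CoverFace τ o × Fin 3) (hd : coverCorner α β τ o d.1 d.2 = none) :
    Reach (H(2, o), 0) d := by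
  have step : ∀ (x y : Fin 6) (π : Perm S), hexNext x = y → hexVolt α β τ x = π →
      (∀ s, Reach (H(2, o), 0) (H(x, s), 0)) → ∀ s, Reach (H(2, o), 0) (H(y, s), 0) := by
    rintro x y π rfl rfl h s
    have := (h ((hexVolt α β τ x)⁻¹ s)).tail (step_center x _).1
    rwa [perm_apply_inv_self] at this
  have hpow : ∀ j : ℕ, Reach (H(2, o), 0) (H(2, ((β⁻¹ * α * β * α⁻¹ * τ) ^ j) o), 0) := by
    intro j
    induction j with
    | zero => exact .refl
    | succ j ih =>
      rw [pow_succ', Perm.mul_apply]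
      -- The hexagon is `2 → 0 → 4 → 3 → 5 → 1 → 2`, with sheet changes `τ, α⁻¹, β, 1, α, β⁻¹` in
      -- this order.
      exact (((((ih.tail (step_center 2 _).1).tail (step_center 0 _).1).tail
        (step_center 4 _).1).tail (step_center 3 _).1).tail (step_center 5 _).1).tail
        (step_center 1 _).1
  have h2 : ∀ s, Reach (H(2, o), 0) (H(2, s), 0) := by
    intro s
    obtain ⟨j, rfl⟩ := hρ s
    exact hpow j
  have h0 := step 2 0 _ rfl rfl h2
  have h4 := step 0 4 _ rfl rfl h0
  have h3 := step 4 3 _ rfl rfl h4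
  have h5 := step 3 5 _ rfl rfl h3
  have h1 := step 5 1 _ rfl rfl h5
  obtain ⟨⟨j, t⟩ | ⟨y, t⟩ | ⟨_ | _, t⟩, k⟩ := d
  · simp [coverCorner] at hd
  · have : k = 0 := by
      fin_cases k
      · rfl
      · simp [coverCorner] at hd
      · simp [coverCorner] at hd
    subst this
    fin_cases y
    exacts [h0 t, h1 t, h2 t, h3 t, h4 t, h5 t]
  · fin_cases k <;> simp [coverCorner] at hd
  · fin_cases k <;> simp [coverCorner] at hd

theorem exists_coverCorner_eq (α β τ : Perm S) (o : S) (v : Option (Fin 6 × S)) :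
    ∃ f k, coverCorner α β τ o f k = v := by
  rcases v with _ | ⟨x, s⟩
  · exact ⟨.inr (.inl (0, o)), 0, rfl⟩
  · exact ⟨.inr (.inl (x, s)), 1, rfl⟩

variable [Fintype S] [DecidableEq S]

/-- The ramified covering as a simplicial complex. -/
abbrev coverComplex (α β τ : Perm S) (o : S) : AbstractSimplicialComplex (Option (Fin 6 × S)) :=
  triangleComplex (coverCorner α β τ o) (exists_coverCorner_eq α β τ o)

theorem isOrientedTriangulation_coverComplex (hτ : τ.IsCycle) (ho : τ o ≠ o)
    (hρ : ∀ s, ∃ j : ℕ, ((β⁻¹ * α * β * α⁻¹ * τ) ^ j) o = s) :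
    IsOrientedTriangulation (coverComplex α β τ o) (coverCorner α β τ o) where
  mem_faces := mem_triangleComplex
  ne := coverCorner_ne
  edge_inj := coverCorner_edge_inj
  exists_rev := exists_rev_of_exists_linkStep (exists_properStep ho)
  link v := by
    rcases v with _ | ⟨x, s⟩
    · exact ⟨_, rfl, reach_none hρ⟩
    · exact ⟨(H(x, s), 1), rfl, reach_some hτ ho x s⟩
  hub := by
    refine ⟨none, fun v hv => ?_⟩
    rcases v with _ | ⟨x, s⟩
    · exact absurd rfl hv
    · exact ⟨H(x, s), 0, rfl, rfl⟩

end

end SurfaceMaps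

/-! ### Degree and genus of the covering. -/

namespace SurfaceMaps
open Relation Equiv

section

variable {S : Type} {α β τ : Perm S} {o : S}

/-- The projection of the ramified covering to `torus₇` on vertices. -/
def coverProj : Option (Fin 6 × S) → Fin 7
  | none => 6
  | some (x, _) => x.castSucc

theorem torusCorner_castAdd : ∀ (j : Fin 8) (k : Fin 3),
    (baseVert j k).castSucc = torusCorner (Fin.castAdd 6 j) k := by decide

theorem torusCorner_natAdd : ∀ x : Fin 6,
    ![6, x.castSucc, (hexNext x).castSucc] = torusCorner (Fin.natAdd 8 x) := by decide

theorem coverProj_base (j : Fin 8) (s : S) :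
    coverProj ∘ coverCorner α β τ o (.inl (j, s)) = torusCorner (Fin.castAdd 6 j) :=
  funext fun k => torusCorner_castAdd j k

theorem coverProj_hex (x : Fin 6) (s : S) :
    coverProj ∘ coverCorner α β τ o (.inr (.inl (x, s))) = torusCorner (Fin.natAdd 8 x) := by
  rw [← torusCorner_natAdd]
  funext k
  fin_cases k <;> rfl

theorem coverProj_slit (b : Bool) (s : {s // τ s ≠ s ∧ s ≠ o}) :
    coverProj ∘ coverCorner α β τ o (.inr (.inr (b, s))) = ![2, cond b 2 0, cond b 0 2] := by
  funext k
  cases b <;> fin_cases k <;> rfl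

theorem exists_image_coverProj_subset (f : CoverFace τ o) :
    ∃ g, Finset.univ.image (coverProj ∘ coverCorner α β τ o f)
      ⊆ Finset.univ.image (torusCorner g) := by
  rcases f with ⟨j, s⟩ | ⟨x, s⟩ | ⟨b, s⟩
  · exact ⟨_, by rw [coverProj_base]⟩
  · exact ⟨_, by rw [coverProj_hex]⟩
  · refine ⟨10, ?_⟩
    rw [coverProj_slit]
    revert b
    decide

theorem torusCorner_sign_sum : ∀ g : Fin 14, (∑ π : Perm (Fin 3),
    if torusCorner g ∘ π = torusCorner 6 then (Perm.sign π : ℤ) else 0) = if g = 6 then 1 else 0 := by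
  decide +kernel

theorem slit_sign_sum : ∀ b : Bool, (∑ π : Perm (Fin 3),
    if (![2, cond b 2 0, cond b 0 2] : Fin 3 → Fin 7) ∘ π = torusCorner 6
      then (Perm.sign π : ℤ) else 0) = 0 := by
  decide +kernel

variable [Fintype S] [DecidableEq S]

/-- Triangle `6` of the torus avoids the ramification vertex and is covered once, positively, in
each sheet. Fan triangles have degenerate images. -/
theorem cover_sign_sum : (∑ f : CoverFace τ o, ∑ π : Perm (Fin 3),
    if (coverProj ∘ coverCorner α β τ o f) ∘ π = torusCorner 6 then (Perm.sign π : ℤ) else 0)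
      = Fintype.card S := by
  rw [Fintype.sum_sum_type, Fintype.sum_sum_type, Fintype.sum_prod_type, Fintype.sum_prod_type,
    Fintype.sum_prod_type]
  simp only [coverProj_base, coverProj_hex, coverProj_slit, torusCorner_sign_sum, slit_sign_sum,
    Finset.sum_const_zero, add_zero]
  have h1 : ∀ x : Fin 6, Fin.natAdd 8 x ≠ 6 := by decide
  have h2 : ∀ j : Fin 8, Fin.castAdd 6 j = 6 ↔ j = 6 := by decide
  simp only [h1, h2, if_false, Finset.sum_const_zero, add_zero]
  rw [Finset.sum_comm]
  simp

/-- The ramified coverings realise the degree `card S`, on any vertex set of the right size. -/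
theorem exists_surface_of_perm (hτ : τ.IsCycle) (ho : τ o ≠ o)
    (hρ : ∀ s, ∃ j : ℕ, ((β⁻¹ * α * β * α⁻¹ * τ) ^ j) o = s) {N g : ℕ}
    (hN : N = 6 * Fintype.card S + 1)
    (hg : (Fintype.card S : ℤ) + τ.support.card = 2 * g) :
    ∃ K : AbstractSimplicialComplex (Fin N), IsTriangulatedOrientableSurface K g ∧
      ∃ (f : SimplicialMap K torus₇) (a : H₂ K) (b : H₂ torus₇),
        HasDegree f a b (Fintype.card S) := by
  have hcard : Fintype.card (Option (Fin 6 × S)) = N := by simp [hN]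
  let e := Fintype.equivFinOfCardEq hcard
  have h := (isOrientedTriangulation_coverComplex hτ ho hρ).relabel e
  have : Nonempty (CoverFace τ o) := ⟨.inl (0, o)⟩
  -- The fan has `2 (m - 1)` triangles, where `m` is the size of the support of `τ`.
  have hslit : Fintype.card {s // τ s ≠ s ∧ s ≠ o} + 1 = τ.support.card := by
    rw [Fintype.card_subtype, ← Finset.card_erase_add_one (Perm.mem_support.2 ho)]
    congr 2
    ext s
    simp [and_comm]
  have hproj : ∀ f, (coverProj ∘ e.symm) ∘ (e ∘ coverCorner α β τ o f)
      = coverProj ∘ coverCorner α β τ o f := by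
    intro f
    funext k
    simp
  let φ : SimplicialMap _ torus₇ := ⟨coverProj ∘ e.symm, fun s hs => by
    obtain ⟨hne, f, hf⟩ := (h.mem_faces s).1 hs
    obtain ⟨g, hg⟩ := exists_image_coverProj_subset (α := α) (β := β) f
    refine (isOrientedTriangulation_torus₇.mem_faces _).2 ⟨hne.image _, g, ?_⟩
    refine (Finset.image_subset_image hf).trans ?_
    rwa [Finset.image_image, hproj]⟩
  refine ⟨_, h.isTriangulatedOrientableSurface ?_, φ, h.fundamentalClass,
    isOrientedTriangulation_torus₇.fundamentalClass, h.isInfiniteCyclicGenerator,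
    isOrientedTriangulation_torus₇.isInfiniteCyclicGenerator, ?_⟩
  · simp only [Fintype.card_sum, Fintype.card_prod, Fintype.card_fin, Fintype.card_bool]
    push_cast
    lia
  · rw [h.mapH₂_fundamentalClass isOrientedTriangulation_torus₇ φ 6]
    congr 1
    rw [← cover_sign_sum (α := α) (β := β) (τ := τ) (o := o)]
    refine Finset.sum_congr rfl fun f _ => Finset.sum_congr rfl fun π _ => ?_
    rw [← hproj f]
    rfl

end

/-! ### Choice of the permutations, and conclusion. -/

/-- Every permutation of odd order is a commutator. -/
theorem exists_commutator_eq {S : Type} [Fintype S] [DecidableEq S] {γ : Perm S} {i : ℕ}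
    (hγ : γ ^ (2 * i + 1) = 1) : ∃ α β : Perm S, β⁻¹ * α * β * α⁻¹ = γ := by
  -- As `γ` has odd order, `γ ^ (i + 1)` is a square root of it. Like every permutation, this root
  -- is conjugate to its inverse, and a conjugator `c` turns `γ ^ (i + 1) * γ ^ (i + 1)` into a
  -- commutator.
  have hconj : IsConj (γ ^ (i + 1))⁻¹ (γ ^ (i + 1)) := by
    rw [Perm.isConj_iff_cycleType_eq, Perm.cycleType_inv]
  obtain ⟨c, hc⟩ := isConj_iff.1 hconj
  refine ⟨(γ ^ (i + 1))⁻¹, c⁻¹, ?_⟩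
  rw [inv_inv, hc, inv_inv, ← pow_add, show i + 1 + (i + 1) = 2 * i + 1 + 1 by ring, pow_succ, hγ,
    one_mul]

/-- The cycles on `0, …, 2i` and on `2i, …, n - 1` meet only in `2i`, so their product is the cycle
on all points. The first has odd order and is a commutator; the second is `τ`, non-trivial because
`2i < n - 1`. -/
theorem exists_perms {n i : ℕ} (hi : 2 * i + 2 ≤ n) :
    ∃ (α β τ : Perm (Fin n)) (o : Fin n), τ.IsCycle ∧ τ o ≠ o ∧ τ.support.card = n - 2 * i ∧
      ∀ s, ∃ j : ℕ, ((β⁻¹ * α * β * α⁻¹ * τ) ^ j) o = s := by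
  have : NeZero n := ⟨by lia⟩
  let a : Fin n := ⟨2 * i, by lia⟩
  let z : Fin n := ⟨n - 1, by lia⟩
  have haz : a < z := by simp [Fin.lt_def, a, z]; lia
  have hz : ∀ s, s ≤ z := fun s => by
    have := s.2
    simp only [Fin.le_def, z]; lia
  have hne : ∀ b s : Fin n, b ≤ s → b < z → Fin.cycleIcc b z s ≠ s := by
    intro b s hbs hbz e
    rw [Fin.cycleIcc_of_le_of_le hbs (hz s)] at e
    split_ifs at e with hs
    · rw [e, hs] at hbz
      exact lt_irrefl _ hbz
    · have h1 : (1 : Fin n) = 0 := by simpa using e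
      have := congrArg Fin.val h1
      rw [Fin.val_one', Nat.mod_eq_of_lt (by lia)] at this
      simp at this
  have hγ : Fin.cycleIcc 0 a ^ (2 * i + 1) = 1 := by
    -- For `i = 0` the interval is a point and the cycle is the identity, to which the cycle type
    -- formula does not apply.
    rcases Nat.eq_zero_or_pos i with rfl | hpos
    · have : a = 0 := Fin.ext (by simp [a])
      rw [this, Fin.cycleIcc_eq, one_pow]
    · have h0a : (0 : Fin n) < a := by simp [Fin.lt_def, a]; lia
      have h1 : orderOf (Fin.cycleIcc 0 a) = 2 * i + 1 := by
        rw [← Perm.lcm_cycleType, Fin.cycleType_cycleIcc_of_lt h0a]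
        simp [a]
      rw [← h1, pow_orderOf_eq_one]
  obtain ⟨α, β, hαβ⟩ := exists_commutator_eq hγ
  refine ⟨α, β, Fin.cycleIcc a z, a, Fin.isCycle_cycleIcc haz, hne a a le_rfl haz, ?_, ?_⟩
  · rw [← Perm.sum_cycleType, Fin.cycleType_cycleIcc_of_lt haz, Multiset.sum_singleton]
    simp only [a, z]
    lia
  · intro s
    have hρ : Fin.cycleIcc 0 a * Fin.cycleIcc a z = Fin.cycleIcc 0 z :=
      Equiv.ext fun x => congrFun (Fin.cycleIcc.trans (Fin.zero_le a) haz.le) x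
    have h0z : (0 : Fin n) < z := lt_of_le_of_lt (Fin.zero_le a) haz
    rw [hαβ, hρ]
    exact (Fin.isCycle_cycleIcc h0z).exists_pow_eq (hne 0 a (Fin.zero_le a) h0z)
      (hne 0 s (Fin.zero_le s) h0z)

theorem HasDegree.neg {V W : Type} [Fintype V] [DecidableEq V] [Fintype W] [DecidableEq W]
    {K : AbstractSimplicialComplex V} {L : AbstractSimplicialComplex W} {f : SimplicialMap K L}
    {a : H₂ K} {b : H₂ L} {d : ℤ} (h : HasDegree f a b d) : HasDegree f (-a) b (-d) := by
  refine ⟨?_, h.2.1, by rw [map_neg, h.2.2, neg_smul]⟩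
  have : (fun n : ℤ => n • -a) = (fun n : ℤ => n • a) ∘ Neg.neg := by
    funext n
    simp
  rw [IsInfiniteCyclicGenerator, this]
  exact h.1.comp (Equiv.neg ℤ).bijective

end SurfaceMaps

theorem theorem3p4 (g i : ℕ) (d : ℤ) (hg : 2 ≤ g) (hi : i ≤ g - 2) (hd : |d| = (g : ℤ) + i) :
    SurfaceMaps.IsTriangulatedOrientableSurface SurfaceMaps.torus₇ 1 ∧
    ∃ K : AbstractSimplicialComplex (Fin (6 * d.natAbs + 1)),
      SurfaceMaps.IsTriangulatedOrientableSurface K g ∧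
      ∃ (f : SurfaceMaps.SimplicialMap K SurfaceMaps.torus₇)
        (α : SurfaceMaps.H₂ K) (β : SurfaceMaps.H₂ SurfaceMaps.torus₇),
        SurfaceMaps.HasDegree f α β d := by
  -- Genus one: `2 * 7 - 14 = 0 = 4 - 4 * 1`.
  refine ⟨SurfaceMaps.isOrientedTriangulation_torus₇.isTriangulatedOrientableSurface (by simp), ?_⟩
  have hn : d.natAbs = g + i := by
    rw [Int.abs_eq_natAbs] at hd
    exact_mod_cast hd
  obtain ⟨α, β, τ, o, hτ, ho, hsupp, hρ⟩ :=
    SurfaceMaps.exists_perms (n := d.natAbs) (i := i) (by lia)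
  -- The genus condition reads `n + (n - 2i) = 2g` with `n = g + i`.
  obtain ⟨K, hK, f, a, b, hdeg⟩ := SurfaceMaps.exists_surface_of_perm hτ ho hρ
    (N := 6 * d.natAbs + 1) (g := g) (by simp) (by rw [Fintype.card_fin, hsupp]; lia)
  refine ⟨K, hK, f, ?_⟩
  rw [Fintype.card_fin] at hdeg
  -- For negative `d` the same map is used with the opposite orientation of `K`.
  rcases Int.natAbs_eq d with h | h
  · exact ⟨a, b, (congrArg (SurfaceMaps.HasDegree f a b) h).mpr hdeg⟩
  · exact ⟨-a, b, (congrArg (SurfaceMaps.HasDegree f (-a) b) h).mpr hdeg.neg⟩
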